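/- Let $\log$ be the principal logarithm, let $\gamma$ be Euler's constant, $\psi=\Gamma'/\Gamma$ the digamma function, $$\gamma_1=\lim_{n\to\infty}\Big(\sum_{j=1}^{n}\frac{\log j}{j}-\frac{\log^2 n}{2}\Big)$$ the first Stieltjes constant, and for $z\in\mathbb{C}\setminus(-\infty,0]$ let $$\psi_1(z)=-\gamma_1-\frac{\log z}{z}-\sum_{n=1}^{\infty}\Big(\frac{\log(n+z)}{n+z}-\frac{\log n}{n}\Big).$$ Let $w\in\mathbb{C}$ with $\mathrm{Re}(w)>0$. Then for every $m\ge 1$ the improper integral $$\int_0^\infty\frac{u\cos(u)\log(u/w)}{u^2+(2\pi m w)^2}\,du=\lim_{T\to\infty}\int_0^T\frac{u\cos(u)\log(u/w)}{u^2+(2\pi m w)^2}\,du$$ converges, the series of these integrals over $m\ge 1$ converges absolutely, and $$4\sum_{m=1}^{\infty}\int_0^\infty\frac{u\cos(u)\log(u/w)}{u^2+(2\pi m w)^2}\,du=\psi_1(iw)-\tfrac12\log^2(iw)+\psi_1(-iw)-\tfrac12\log^2(-iw)+\frac{\pi}{2w}+\gamma\big(\psi(iw)+\psi(-iw)-2\log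 w\big).$$ -/

import Mathlib

open Filter Topology MeasureTheory

/-- The first Stieltjes constant `γ₁ = lim_{n → ∞} (∑_{j=1}^n log j / j - (log n)² / 2)`. -/
noncomputable def stieltjesGammaOne : ℝ :=
  limUnder atTop (fun n : ℕ =>
    ∑ j ∈ Finset.Icc 1 n, Real.log (j : ℝ) / (j : ℝ) - Real.log (n : ℝ) ^ 2 / 2)

/-- The generalized digamma function
`ψ₁(z) = -γ₁ - log z / z - ∑_{n ≥ 1} (log (n + z) / (n + z) - log n / n)`,
meant for `z` in the complex plane cut along the non-positive reals (principal logarithms).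
The series is indexed from `0`, so its `n`-th term is the one for `n + 1`. -/
noncomputable def psiOne (z : ℂ) : ℂ :=
  -(stieltjesGammaOne : ℂ) - Complex.log z / z -
    ∑' n : ℕ, (Complex.log (((n + 1 : ℕ) : ℂ) + z) / (((n + 1 : ℕ) : ℂ) + z)
      - Complex.log ((n + 1 : ℕ) : ℂ) / ((n + 1 : ℕ) : ℂ))

/-- The improper integral `∫₀^∞ f(u) du = lim_{T → ∞} ∫₀^T f(u) du` exists and equals `I`.
The convergence at infinity may be conditional. -/
def HasImproperIntegral (f : ℝ → ℂ) (I : ℂ) : Prop :=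
  (∀ T : ℝ, 0 < T → IntervalIntegrable f volume 0 T) ∧
    Tendsto (fun T : ℝ => ∫ u in (0 : ℝ)..T, f u) atTop (𝓝 I)

/-!
Write `t = u / w`, which runs over the ray through `1 / w`, and let
`K(u) = 1 / (e^t - 1) - 1 / t + 1 / 2` be the Binet kernel (`binetKernel`). The partial fraction
expansion of the cotangent says `∑_m u / (u² + (2πmw)²) = K(u) / (2w)` (`hasSum_binetKernel`), so
four times the sum of the integrals is formally `(2 / w) ∫ cos u · log (u / w) · K(u) du`. Splitting
the cosine into exponentials, this is the sum over `c = ±i` of the Laplace integrals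
`(1 / w) ∫ e^{-cu} log (u / w) K(u) du`, which converge absolutely for `0 < re c`.

For `0 < re c` and `z = cw`, the Laplace integral has a closed form
(`integral_logRay_mul_binetKernel`). Indeed `∫ e^{-su} (log u + γ) du = -log s / s`, and after
expanding `1 / (e^t - 1)` in a geometric series and writing `1 / t` by Frullani's integral, the
Laplace integral against `K` becomes the Euler–Maclaurin defect
`lim_N (∑_{n ≤ N} λ(n) - ∫_0^N λ + λ(0) / 2)` with `λ(v)` equal to `-log (z + v) / (z + v)` for the
weight `log t + γ`, and to `1 / (z + v)` for the weight `1`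
(`IsLogWeight.tendsto_sum_sub_integral`). These limits are `psiOne z` and `-digamma z` up to
elementary terms. Integrating along the ray through `1 / w` instead of the positive axis makes the
argument uniform in `w`: no analytic continuation in `w` is needed. The case `w = c = 1` also shows
that the limit defining `γ₁` exists.

The passage to `c = ±i` is by dominated convergence. With `f_m = rayIntegrand w m` the
non-oscillating factor of the `m`-th integrand, two integrations by parts turn `∫ e^{-cu} f_m(u) du`
into `partsIntegral w c m`, which converges absolutely for `0 ≤ re c`, `c ≠ 0`, depends continuously
on `c`, and is `O(m^{-3/2})` (`exists_norm_partsIntegral_le`). This gives at once the convergence of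
the improper integrals, the absolute convergence of their sum, and Abel's limit `c → ±i` in the
closed form (`tsum_partsIntegral_of_re_nonneg`). Finally
`log (±iw) = log w ± iπ / 2` produces the terms `π / (2w)` and `-2γ log w`.
-/

/-! ### Partial fractions of the Binet kernel -/

/-- The poles `±i·a` of the `m`-th integrand are given by `a = 2π(m+1)w`. -/
noncomputable def poleParam (w : ℂ) (m : ℕ) : ℂ := 2 * (Real.pi : ℂ) * ((m + 1 : ℕ) : ℂ) * w

/-- The denominators stay away from zero uniformly in `u` and `m`: both factors `u ± i·2π(m+1)w` are
at least of the order of `u + m + 1`, since `0 < re w`. -/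
theorem exists_sq_add_sq_le_norm {w : ℂ} (hw : 0 < w.re) :
    ∃ C : ℝ, 0 < C ∧ ∀ (m : ℕ) (u : ℝ), 0 ≤ u →
      u ^ 2 + ((m : ℝ) + 1) ^ 2 ≤ C * ‖(u : ℂ) ^ 2 + poleParam w m ^ 2‖ := by
  set r : ℝ := 2 * Real.pi * w.re with hr
  have hr0 : 0 < r := by positivity
  set s : ℝ := 2 * Real.pi * ‖w‖ with hs
  have hs0 : 0 ≤ s := by positivity
  have key : ∀ (m : ℕ) (u : ℝ) (v : ℂ), 0 ≤ u → ‖v‖ = ((m : ℝ) + 1) * s →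
      ((m : ℝ) + 1) * r ≤ |v.im| → u + ((m : ℝ) + 1) ≤ (1 + (s + 1) / r) * ‖(u : ℂ) + v‖ := by
    intro m u v hu hv him
    have h1 : ((m : ℝ) + 1) * r ≤ ‖(u : ℂ) + v‖ := by
      have := Complex.abs_im_le_norm ((u : ℂ) + v)
      simp only [Complex.add_im, Complex.ofReal_im, zero_add] at this
      linarith
    have h2 : u ≤ ‖(u : ℂ) + v‖ + ((m : ℝ) + 1) * s := by
      have := norm_sub_le ((u : ℂ) + v) v
      rw [add_sub_cancel_right, Complex.norm_real, Real.norm_of_nonneg hu, hv] at this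
      exact this
    have h3 : ((m : ℝ) + 1) * (s + 1) ≤ (s + 1) / r * ‖(u : ℂ) + v‖ := by
      have h := mul_le_mul_of_nonneg_left h1 (show 0 ≤ (s + 1) / r by positivity)
      refine le_trans (le_of_eq ?_) h
      field_simp
    linarith
  refine ⟨(1 + (s + 1) / r) ^ 2, by positivity, fun m u hu => ?_⟩
  have hnorm : ‖poleParam w m‖ = ((m : ℝ) + 1) * s := by
    rw [poleParam, norm_mul, norm_mul, norm_mul, Complex.norm_natCast, Complex.norm_real,
      Real.norm_of_nonneg Real.pi_nonneg, hs]
    push_cast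
    simp
    ring
  have hre : (poleParam w m).re = ((m : ℝ) + 1) * r := by
    have : poleParam w m = ((2 * Real.pi * ((m : ℝ) + 1) : ℝ) : ℂ) * w := by
      rw [poleParam]; push_cast; ring
    rw [this, Complex.re_ofReal_mul, hr]; ring
  have h1 := key m u (Complex.I * poleParam w m) hu (by simp [hnorm])
    (by simp only [Complex.mul_im, Complex.I_re, Complex.I_im, zero_mul, one_mul, zero_add, hre]
        exact le_abs_self _)
  have h2 := key m u (-(Complex.I * poleParam w m)) hu (by simp [hnorm])
    (by simp only [Complex.neg_im, Complex.mul_im, Complex.I_re, Complex.I_im, zero_mul, one_mul,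
          zero_add, hre, abs_neg]
        exact le_abs_self _)
  have hfac : (u : ℂ) ^ 2 + poleParam w m ^ 2
      = ((u : ℂ) + Complex.I * poleParam w m) * ((u : ℂ) + -(Complex.I * poleParam w m)) := by
    linear_combination (poleParam w m ^ 2) * Complex.I_sq
  rw [hfac, norm_mul]
  have hm : (0 : ℝ) ≤ m := Nat.cast_nonneg m
  calc u ^ 2 + ((m : ℝ) + 1) ^ 2 ≤ (u + ((m : ℝ) + 1)) * (u + ((m : ℝ) + 1)) := by nlinarith
    _ ≤ _ := mul_le_mul h1 h2 (by positivity) (by positivity)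
    _ = _ := by ring

theorem sq_add_poleParam_sq_ne_zero {w : ℂ} (hw : 0 < w.re) (m : ℕ) {u : ℝ} (hu : 0 ≤ u) :
    (u : ℂ) ^ 2 + poleParam w m ^ 2 ≠ 0 := by
  obtain ⟨C, hC, h⟩ := exists_sq_add_sq_le_norm hw
  intro h0
  have := h m u hu
  rw [h0, norm_zero, mul_zero] at this
  nlinarith [sq_nonneg u, Nat.cast_nonneg (α := ℝ) m]

/-- The remainder `1/(e^t - 1) - 1/t + 1/2` of the Laurent expansion of `1/(e^t - 1)`, taken at the
point `t = u/w` of the ray through `1/w`. -/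
noncomputable def binetKernel (w : ℂ) (u : ℝ) : ℂ :=
  1 / (Complex.exp (u / w) - 1) - w / u + 1 / 2

/-- The partial fraction expansion of the cotangent, rewritten for the Binet kernel. -/
theorem hasSum_binetKernel {w : ℂ} (hw : 0 < w.re) {u : ℝ} (hu : 0 < u) :
    HasSum (fun m : ℕ => (u : ℂ) / ((u : ℂ) ^ 2 + poleParam w m ^ 2))
      (binetKernel w u / (2 * w)) := by
  have hw0 : w ≠ 0 := by rintro rfl; simp at hw
  have hu0 : (u : ℂ) ≠ 0 := by exact_mod_cast hu.ne'
  have hpi : (Real.pi : ℂ) ≠ 0 := by exact_mod_cast Real.pi_ne_zero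
  -- The cotangent expansion is used at the `x` with `2πi x = u / w`.
  set x : ℂ := -Complex.I * u / (2 * Real.pi * w) with hx
  have hxw : x * (2 * Real.pi * w) = -Complex.I * u := by rw [hx]; field_simp
  have hxZ : x ∈ Complex.integerComplement := by
    rintro ⟨k, hk⟩
    have h1 : ((2 * Real.pi * k : ℝ) : ℂ) * w = -Complex.I * u := by
      rw [← hxw, ← hk]; push_cast; ring
    have h2 := congrArg Complex.re h1
    rw [Complex.re_ofReal_mul] at h2
    simp at h2
    rcases h2 with (h2 | h2)
    · have : x = 0 := by rw [← hk, h2]; simp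
      rw [this, zero_mul] at hxw
      have := mul_ne_zero (neg_ne_zero.mpr Complex.I_ne_zero) hu0
      exact this hxw.symm
    · exact hw.ne' h2
  have hsum := (summable_cotTerm hxZ).hasSum
  have hval := cot_series_rep' hxZ
  have hE : Complex.exp ((u : ℂ) / w) - 1 ≠ 0 := by
    intro h
    obtain ⟨k, hk⟩ := Complex.exp_eq_one_iff.mp (sub_eq_zero.mp h)
    apply hxZ
    refine ⟨k, ?_⟩
    rw [div_eq_iff hw0] at hk
    rw [hx, hk]
    field_simp
    linear_combination (k : ℂ) * Complex.I_sq
  have h2 : 2 * Real.pi * Complex.I * x = (u : ℂ) / w := by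
    rw [hx]
    field_simp
    linear_combination - Complex.I_sq
  have hcot : (Real.pi : ℂ) * Complex.cot (Real.pi * x) - 1 / x
      = 2 * Real.pi * Complex.I * binetKernel w u := by
    rw [Complex.cot_pi_eq_exp_ratio, h2, binetKernel, hx]
    have hE' : 1 - Complex.exp ((u : ℂ) / w) ≠ 0 := by
      intro h; apply hE; linear_combination -h
    generalize Complex.exp ((u : ℂ) / w) = E at *
    have hI := Complex.I_ne_zero
    have e1 : (E + 1) / (Complex.I * (1 - E)) = Complex.I * (1 + 2 * (1 / (E - 1))) := by
      field_simp
      linear_combination (- (E+1) * (1 - E)) * Complex.I_sq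
    have e2 : 1 / (-Complex.I * ↑u / (2 * ↑Real.pi * w)) = 2 * Real.pi * Complex.I * (w / u) := by
      field_simp
      linear_combination - Complex.I_sq
    rw [e1, e2]
    ring
  have hc : (4 * Real.pi * Complex.I * w) ≠ 0 := by simp [hpi, hw0]
  have hterm : ∀ m : ℕ, (u : ℂ) / ((u : ℂ) ^ 2 + poleParam w m ^ 2)
      = (4 * Real.pi * Complex.I * w)⁻¹ * cotTerm x m := by
    intro m
    have hden := sq_add_poleParam_sq_ne_zero hw m hu.le
    have hx2 : ((x + (m + 1)) * (x - (m + 1))) * (2 * Real.pi * w) ^ 2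
        = - ((u : ℂ) ^ 2 + poleParam w m ^ 2) := by
      rw [poleParam]; push_cast
      linear_combination (x * (2 * Real.pi * w) + (-Complex.I * u)) * hxw
        + (u : ℂ) ^ 2 * Complex.I_sq
    have hP : (x + (m + 1)) * (x - (m + 1)) ≠ 0 := by
      intro h; rw [h, zero_mul] at hx2; exact hden (neg_eq_zero.mp hx2.symm)
    rw [cotTerm_identity hxZ, inv_mul_eq_div, eq_div_iff hc, div_mul_eq_mul_div, mul_one_div,
      div_eq_div_iff hden hP]
    have hI := Complex.I_sq
    have : ((u : ℂ) ^ 2 + poleParam w m ^ 2)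
        = -(((x + (m + 1)) * (x - (m + 1))) * (2 * Real.pi * w) ^ 2) := by rw [hx2]; ring
    rw [this]
    generalize (x + (m + 1)) * (x - (m + 1)) = P at *
    linear_combination (2 * P * 2 * Real.pi * w) * hxw
  have hv : binetKernel w u / (2 * w)
      = (4 * Real.pi * Complex.I * w)⁻¹ * ∑' m : ℕ, cotTerm x m := by
    have : ∑' m : ℕ, cotTerm x m = 2 * Real.pi * Complex.I * binetKernel w u := by
      rw [← hcot, hval]
    rw [this]
    have hI := Complex.I_ne_zero
    field_simp
    ring
  rw [hv]
  simp_rw [hterm]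
  exact hsum.mul_left _

/-! ### Laplace transforms of logarithmic weights -/

/-- The logarithm `log (u / w)` along the positive reals, in the form `log u - log w`. -/
noncomputable def logRay (w : ℂ) (u : ℝ) : ℂ := (Real.log u : ℂ) - Complex.log w

theorem log_ofReal_div_eq_logRay {w : ℂ} (hw : 0 < w.re) {u : ℝ} (hu : 0 < u) :
    Complex.log ((u : ℂ) / w) = logRay w u := by
  have hw0 : w ≠ 0 := by rintro rfl; simp at hw
  have harg : w.arg ≠ Real.pi := by
    have h := Complex.abs_arg_lt_pi_div_two_iff.mpr (Or.inl hw)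
    rw [abs_lt] at h
    have := Real.pi_pos
    linarith [h.2]
  rw [div_eq_mul_inv, Complex.log_ofReal_mul hu (inv_ne_zero hw0), Complex.log_inv _ harg, logRay]
  ring

/-- A weight on the positive reals that is continuous and grows at most like a logarithm at both
ends; the exponent `1/4` is a convenient crude bound. -/
def IsLogWeight (ω : ℝ → ℂ) : Prop :=
  ContinuousOn ω (Set.Ioi 0) ∧
    ∃ C : ℝ, 0 < C ∧ ∀ u : ℝ, 0 < u → ‖ω u‖ ≤ C * (u ^ (1 / 4 : ℝ) + u ^ (-(1 / 4) : ℝ))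

theorem one_le_rpow_add_rpow_neg {u : ℝ} (hu : 0 < u) :
    1 ≤ u ^ (1 / 4 : ℝ) + u ^ (-(1 / 4) : ℝ) := by
  rcases le_total 1 u with h | h
  · have := Real.one_le_rpow h (show (0 : ℝ) ≤ 1 / 4 by norm_num)
    have := Real.rpow_nonneg hu.le (-(1 / 4) : ℝ)
    linarith
  · have := Real.one_le_rpow_of_pos_of_le_one_of_nonpos hu h (show (-(1 / 4) : ℝ) ≤ 0 by norm_num)
    have := Real.rpow_nonneg hu.le (1 / 4 : ℝ)
    linarith

theorem abs_log_le_rpow_add_rpow_neg {u : ℝ} (hu : 0 < u) :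
    |Real.log u| ≤ 4 * (u ^ (1 / 4 : ℝ) + u ^ (-(1 / 4) : ℝ)) := by
  have h1 := Real.log_le_rpow_div hu.le (show (0 : ℝ) < 1 / 4 by norm_num)
  have h2 := Real.log_le_rpow_div (inv_nonneg.mpr hu.le) (show (0 : ℝ) < 1 / 4 by norm_num)
  rw [Real.log_inv, Real.inv_rpow hu.le, ← Real.rpow_neg hu.le] at h2
  have := Real.rpow_nonneg hu.le (-(1 / 4) : ℝ)
  have := Real.rpow_nonneg hu.le (1 / 4 : ℝ)
  rw [abs_le]
  constructor <;> linarith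

theorem isLogWeight_const (a : ℂ) : IsLogWeight fun _ => a := by
  refine ⟨continuousOn_const, ‖a‖ + 1, by positivity, fun u hu => ?_⟩
  have := one_le_rpow_add_rpow_neg hu
  nlinarith [norm_nonneg a]

theorem isLogWeight_logRay_add (w a : ℂ) : IsLogWeight fun u => logRay w u + a := by
  refine ⟨?_, 4 + (‖Complex.log w‖ + ‖a‖), by positivity, fun u hu => ?_⟩
  · have : ContinuousOn Real.log (Set.Ioi 0) :=
      Real.continuousOn_log.mono fun x hx => (ne_of_gt hx : x ≠ 0)
    unfold logRay
    exact ((Complex.continuous_ofReal.comp_continuousOn this).sub continuousOn_const).add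
      continuousOn_const
  · have h1 := one_le_rpow_add_rpow_neg hu
    have h2 := abs_log_le_rpow_add_rpow_neg hu
    have h3 : ‖logRay w u + a‖ ≤ |Real.log u| + ‖Complex.log w‖ + ‖a‖ := by
      refine (norm_add_le _ _).trans (add_le_add ((norm_sub_le _ _).trans ?_) le_rfl)
      rw [Complex.norm_real, Real.norm_eq_abs]
    have : 0 ≤ ‖Complex.log w‖ + ‖a‖ := by positivity
    nlinarith

theorem norm_exp_neg_mul_ofReal (c : ℂ) (u : ℝ) :
    ‖Complex.exp (-(c * u))‖ = Real.exp (-c.re * u) := by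
  rw [Complex.norm_exp]; simp

theorem integrableOn_exp_mul_rpow {b p : ℝ} (hb : 0 < b) (hp : -1 < p) :
    IntegrableOn (fun u : ℝ => Real.exp (-b * u) * u ^ p) (Set.Ioi 0) := by
  have := integrableOn_rpow_mul_exp_neg_mul_rpow hp (zero_lt_one) hb
  simpa [mul_comm] using this

/-- The integrable function that dominates Laplace integrals with a logarithmic weight and a factor
of order at most `1 + √u`. -/
theorem integrableOn_exp_mul_logWeight_bound {b : ℝ} (hb : 0 < b) :
    IntegrableOn (fun u : ℝ => Real.exp (-b * u) *
      ((u ^ (1 / 4 : ℝ) + u ^ (-(1 / 4) : ℝ)) * (1 + u ^ (1 / 2 : ℝ)))) (Set.Ioi 0) := by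
  have h := (((integrableOn_exp_mul_rpow hb (show (-1 : ℝ) < 1 / 4 by norm_num)).add
    (integrableOn_exp_mul_rpow hb (show (-1 : ℝ) < -(1 / 4) by norm_num))).add
    (integrableOn_exp_mul_rpow hb (show (-1 : ℝ) < 3 / 4 by norm_num))).add
    (integrableOn_exp_mul_rpow hb (show (-1 : ℝ) < 1 / 4 by norm_num))
  refine h.congr_fun (fun u hu => ?_) measurableSet_Ioi
  have hu : 0 < u := hu
  have e1 : u ^ (3 / 4 : ℝ) = u ^ (1 / 4 : ℝ) * u ^ (1 / 2 : ℝ) := by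
    rw [← Real.rpow_add hu]; norm_num
  have e2 : u ^ (1 / 4 : ℝ) = u ^ (-(1 / 4) : ℝ) * u ^ (1 / 2 : ℝ) := by
    rw [← Real.rpow_add hu]; norm_num
  simp only [Pi.add_apply]
  rw [e1]
  linear_combination Real.exp (-b * u) * e2

/-- Integrability of `e^{-cu} ω(u) g(u)` for a logarithmic weight `ω` and `g = O(1 + √u)`. -/
theorem IsLogWeight.integrableOn_exp_mul {ω : ℝ → ℂ} (hω : IsLogWeight ω) {c : ℂ} (hc : 0 < c.re)
    {g : ℝ → ℂ} (hg : AEStronglyMeasurable g (volume.restrict (Set.Ioi 0))) {B : ℝ}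
    (hB : ∀ u : ℝ, 0 < u → ‖g u‖ ≤ B * (1 + u ^ (1 / 2 : ℝ))) :
    IntegrableOn (fun u : ℝ => Complex.exp (-(c * u)) * ω u * g u) (Set.Ioi 0) := by
  obtain ⟨hcont, C, hC, hb⟩ := hω
  refine ((integrableOn_exp_mul_logWeight_bound hc).const_mul (C * B)).mono' ?_ ?_
  · exact (((Continuous.continuousOn (by fun_prop)).mul hcont).aestronglyMeasurable
      measurableSet_Ioi).mul hg
  · filter_upwards [ae_restrict_mem measurableSet_Ioi] with u hu
    have hu : 0 < u := hu
    rw [norm_mul, norm_mul, norm_exp_neg_mul_ofReal]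
    calc _ ≤ Real.exp (-c.re * u) * (C * (u ^ (1 / 4 : ℝ) + u ^ (-(1 / 4) : ℝ)))
          * (B * (1 + u ^ (1 / 2 : ℝ))) := by
          have := hb u hu
          have := hB u hu
          gcongr
      _ = _ := by ring

theorem IsLogWeight.integrableOn_exp {ω : ℝ → ℂ} (hω : IsLogWeight ω) {c : ℂ} (hc : 0 < c.re) :
    IntegrableOn (fun u : ℝ => Complex.exp (-(c * u)) * ω u) (Set.Ioi 0) := by
  have := hω.integrableOn_exp_mul hc (g := fun _ => 1) aestronglyMeasurable_const (B := 1)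
    (fun u hu => by simpa using Real.rpow_nonneg hu.le _)
  simpa using this

theorem integral_exp_neg_mul_Ioi {s : ℂ} (hs : 0 < s.re) :
    ∫ u : ℝ in Set.Ioi 0, Complex.exp (-(s * u)) = 1 / s := by
  have h := integral_exp_mul_complex_Ioi (a := -s) (by simpa using hs) 0
  simp only [neg_mul, Complex.ofReal_zero, mul_zero, Complex.exp_zero] at h
  rw [h]; simp

/-- The Laplace integral of the logarithm at a real point, by scaling from `Γ'(1) = -γ`. -/
theorem integral_exp_neg_mul_log_of_pos {r : ℝ} (hr : 0 < r) :
    ∫ u : ℝ in Set.Ioi 0, Complex.exp (-((r : ℂ) * u)) * (Real.log u : ℂ)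
      = -((Real.eulerMascheroniConstant : ℂ) + (Real.log r : ℂ)) / r := by
  have hr0 : (r : ℂ) ≠ 0 := by exact_mod_cast hr.ne'
  have h1 : ∫ u : ℝ in Set.Ioi 0, Complex.exp (-(u : ℂ)) * (Real.log u : ℂ)
      = -(Real.eulerMascheroniConstant : ℂ) := by
    have hd := Complex.hasDerivAt_GammaIntegral (s := 1) (by simp)
    have hG : Complex.GammaIntegral =ᶠ[𝓝 1] Complex.Gamma := by
      have : {s : ℂ | 0 < s.re} ∈ 𝓝 (1 : ℂ) :=
        (isOpen_lt continuous_const Complex.continuous_re).mem_nhds (by simp)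
      filter_upwards [this] with s hs
      exact (Complex.Gamma_eq_integral hs).symm
    have := (hd.congr_of_eventuallyEq hG.symm).unique Complex.hasDerivAt_Gamma_one
    rw [← this]
    refine setIntegral_congr_fun measurableSet_Ioi fun u hu => ?_
    simp [mul_comm]
  have h2 := integral_comp_mul_left_Ioi
    (fun v : ℝ => Complex.exp (-(v : ℂ)) * ((Real.log v : ℂ) - (Real.log r : ℂ))) 0 hr
  rw [mul_zero] at h2
  have h3 : ∫ u : ℝ in Set.Ioi 0, Complex.exp (-((r : ℂ) * u)) * (Real.log u : ℂ)
      = ∫ u : ℝ in Set.Ioi 0, Complex.exp (-((r * u : ℝ) : ℂ))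
        * ((Real.log (r * u) : ℂ) - (Real.log r : ℂ)) := by
    refine setIntegral_congr_fun measurableSet_Ioi fun u hu => ?_
    have hu : 0 < u := hu
    rw [Real.log_mul hr.ne' hu.ne']
    push_cast
    ring
  have hw1 : IntegrableOn (fun u : ℝ => Complex.exp (-(u : ℂ)) * (Real.log u : ℂ)) (Set.Ioi 0) := by
    have := (isLogWeight_logRay_add 1 0).integrableOn_exp (c := 1) (by simp)
    simpa [logRay] using this
  have hw2 : IntegrableOn (fun u : ℝ => Complex.exp (-(u : ℂ)) * (Real.log r : ℂ)) (Set.Ioi 0) := by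
    have := (isLogWeight_const (Real.log r : ℂ)).integrableOn_exp (c := 1) (by simp)
    simpa using this
  have h4 : ∫ v : ℝ in Set.Ioi 0, Complex.exp (-(v : ℂ)) * ((Real.log v : ℂ) - (Real.log r : ℂ))
      = -((Real.eulerMascheroniConstant : ℂ) + (Real.log r : ℂ)) := by
    simp_rw [mul_sub]
    rw [integral_sub hw1 hw2, h1, integral_mul_const]
    have := integral_exp_neg_mul_Ioi (s := 1) (by simp)
    simp only [one_mul] at this
    rw [this]; ring
  rw [h3, h2, h4, Complex.real_smul]
  push_cast
  field_simp

/-- The Laplace transform of a logarithmic weight is holomorphic in the right half-plane. -/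
theorem IsLogWeight.differentiableAt_laplace {ω : ℝ → ℂ} (hω : IsLogWeight ω) {s : ℂ}
    (hs : 0 < s.re) :
    DifferentiableAt ℂ (fun s : ℂ => ∫ u : ℝ in Set.Ioi 0, Complex.exp (-(s * u)) * ω u) s := by
  obtain ⟨hcont, C, hC, hb⟩ := id hω
  have hball : Metric.ball s (s.re / 2) ∈ 𝓝 s := Metric.ball_mem_nhds _ (by positivity)
  have hre : ∀ x ∈ Metric.ball s (s.re / 2), s.re / 2 ≤ x.re := by
    intro x hx
    have h1 := Complex.abs_re_le_norm (x - s)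
    rw [mem_ball_iff_norm] at hx
    rw [Complex.sub_re, abs_le] at h1
    linarith [h1.1]
  have hmeas : ∀ x : ℂ, AEStronglyMeasurable (fun u : ℝ => Complex.exp (-(x * u)) * ω u)
      (volume.restrict (Set.Ioi 0)) := fun x =>
    (((Continuous.continuousOn (by fun_prop)).mul hcont).aestronglyMeasurable measurableSet_Ioi)
  have hbd : IntegrableOn (fun u : ℝ => C * (Real.exp (-(s.re / 2) * u) * u ^ (5 / 4 : ℝ)
      + Real.exp (-(s.re / 2) * u) * u ^ (3 / 4 : ℝ))) (Set.Ioi 0) :=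
    ((integrableOn_exp_mul_rpow (half_pos hs) (by norm_num)).add
      (integrableOn_exp_mul_rpow (half_pos hs) (by norm_num))).const_mul C
  refine (hasDerivAt_integral_of_dominated_loc_of_deriv_le (μ := volume.restrict (Set.Ioi 0))
    (F := fun (s : ℂ) (u : ℝ) => Complex.exp (-(s * u)) * ω u)
    (F' := fun (s : ℂ) (u : ℝ) => Complex.exp (-(s * u)) * (-u) * ω u) hball
    (Eventually.of_forall hmeas) (hω.integrableOn_exp hs) ?_ ?_ hbd ?_).2.differentiableAt
  · exact (((Continuous.continuousOn (by fun_prop)).mul hcont).aestronglyMeasurable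
      measurableSet_Ioi)
  · filter_upwards [ae_restrict_mem measurableSet_Ioi] with u hu x hx
    have hu : 0 < u := hu
    have e1 : u ^ (5 / 4 : ℝ) = u * u ^ (1 / 4 : ℝ) := by
      nth_rewrite 2 [← Real.rpow_one u]; rw [← Real.rpow_add hu]; norm_num
    have e2 : u ^ (3 / 4 : ℝ) = u * u ^ (-(1 / 4) : ℝ) := by
      nth_rewrite 2 [← Real.rpow_one u]; rw [← Real.rpow_add hu]; norm_num
    rw [norm_mul, norm_mul, norm_exp_neg_mul_ofReal, norm_neg, Complex.norm_real,
      Real.norm_of_nonneg hu.le, e1, e2]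
    have h1 : Real.exp (-x.re * u) ≤ Real.exp (-(s.re / 2) * u) := by
      have := hre x hx
      gcongr
    calc _ ≤ Real.exp (-(s.re / 2) * u) * u * (C * (u ^ (1 / 4 : ℝ) + u ^ (-(1 / 4) : ℝ))) := by
          have := hb u hu
          gcongr
      _ = _ := by ring
  · filter_upwards with u x _
    have h1 : HasDerivAt (fun x : ℂ => -(x * (u : ℂ))) (-(u : ℂ)) x := by
      simpa using ((hasDerivAt_id x).mul_const (u : ℂ)).fun_neg
    exact (h1.cexp).mul_const (ω u)

/-- The Laplace transform of the logarithm in the right half-plane, by the identity theorem from the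
real points `1 + 1/(n+1)`, which accumulate at `1`. -/
theorem integral_exp_neg_mul_log {s : ℂ} (hs : 0 < s.re) :
    ∫ u : ℝ in Set.Ioi 0, Complex.exp (-(s * u)) * (Real.log u : ℂ)
      = -((Real.eulerMascheroniConstant : ℂ) + Complex.log s) / s := by
  set U : Set ℂ := {s : ℂ | 0 < s.re} with hU
  have hUo : IsOpen U := isOpen_lt continuous_const Complex.continuous_re
  have hslit : ∀ z ∈ U, z ∈ Complex.slitPlane := fun z hz => Or.inl hz
  have hω : IsLogWeight fun u : ℝ => (Real.log u : ℂ) := by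
    simpa [logRay] using isLogWeight_logRay_add 1 0
  have hf : AnalyticOnNhd ℂ
      (fun s : ℂ => ∫ u : ℝ in Set.Ioi 0, Complex.exp (-(s * u)) * (Real.log u : ℂ)) U :=
    DifferentiableOn.analyticOnNhd
      (fun z hz => (hω.differentiableAt_laplace hz).differentiableWithinAt) hUo
  have hg : AnalyticOnNhd ℂ
      (fun s : ℂ => -((Real.eulerMascheroniConstant : ℂ) + Complex.log s) / s) U := by
    refine DifferentiableOn.analyticOnNhd (fun z hz => ?_) hUo
    have hz0 : z ≠ 0 := Complex.slitPlane_ne_zero (hslit z hz)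
    exact ((((differentiableAt_const _).add (Complex.differentiableAt_log (hslit z hz))).neg).div
      differentiableAt_id hz0).differentiableWithinAt
  have hconn : IsPreconnected U := (convex_halfSpace_re_gt 0).isPreconnected
  refine hf.eqOn_of_preconnected_of_frequently_eq hg hconn (z₀ := 1) (by simp [hU]) ?_ hs
  have hlim : Tendsto (fun n : ℕ => (((1 + 1 / ((n : ℝ) + 1) : ℝ)) : ℂ)) atTop (𝓝[≠] 1) := by
    refine tendsto_nhdsWithin_iff.mpr ⟨?_, Eventually.of_forall fun n => ?_⟩
    · have := (tendsto_one_div_add_atTop_nhds_zero_nat (𝕜 := ℝ)).const_add 1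
      rw [add_zero] at this
      exact_mod_cast (Complex.continuous_ofReal.tendsto 1).comp this
    · simp only [Set.mem_compl_iff, Set.mem_singleton_iff]
      intro h
      have : (1 + 1 / ((n : ℝ) + 1) : ℝ) = 1 := by exact_mod_cast h
      have h2 : 0 < 1 / ((n : ℝ) + 1) := by positivity
      linarith
  refine hlim.frequently (Frequently.of_forall fun n => ?_)
  have hp : (0 : ℝ) < 1 + 1 / ((n : ℝ) + 1) := by positivity
  rw [integral_exp_neg_mul_log_of_pos hp, Complex.ofReal_log hp.le]

/-! ### The Euler–Maclaurin defect of a shifted Laplace transform -/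

theorem log_mul_of_re_pos {s w : ℂ} (hs : 0 < s.re) (hw : 0 < w.re) :
    Complex.log (s * w) = Complex.log s + Complex.log w := by
  have h1 := abs_lt.mp (Complex.abs_arg_lt_pi_div_two_iff.mpr (Or.inl hs))
  have h2 := abs_lt.mp (Complex.abs_arg_lt_pi_div_two_iff.mpr (Or.inl hw))
  refine Complex.log_mul (by rintro rfl; simp at hs) (by rintro rfl; simp at hw) ⟨?_, ?_⟩ <;>
    linarith [h1.1, h1.2, h2.1, h2.2]

/-- Along the ray, the constant `γ` in the Laplace transform of the logarithm cancels, and the two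
logarithms combine into that of `s * w`. -/
theorem integral_exp_neg_mul_logRay {s w : ℂ} (hs : 0 < s.re) (hw : 0 < w.re) :
    ∫ u : ℝ in Set.Ioi 0,
        Complex.exp (-(s * u)) * (logRay w u + (Real.eulerMascheroniConstant : ℂ))
      = -Complex.log (s * w) / s := by
  have hω : IsLogWeight fun u : ℝ => (Real.log u : ℂ) := by
    simpa [logRay] using isLogWeight_logRay_add 1 0
  have h : ∀ u : ℝ, Complex.exp (-(s * u)) * (logRay w u + (Real.eulerMascheroniConstant : ℂ))
      = Complex.exp (-(s * u)) * (Real.log u : ℂ) + Complex.exp (-(s * u))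
        * ((Real.eulerMascheroniConstant : ℂ) - Complex.log w) := by
    intro u; rw [logRay]; ring
  simp_rw [h]
  rw [integral_add (hω.integrableOn_exp hs) ((isLogWeight_const _).integrableOn_exp hs),
    integral_exp_neg_mul_log hs, integral_mul_const, integral_exp_neg_mul_Ioi hs,
    log_mul_of_re_pos hs hw]
  ring

/-- Interpolation between `u²` and `n²`. -/
theorem rpow_mul_rpow_le_sq_add_sq {u n : ℝ} (hu : 0 ≤ u) (hn : 0 ≤ n) :
    n ^ (3 / 2 : ℝ) * u ^ (1 / 2 : ℝ) ≤ u ^ 2 + n ^ 2 := by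
  have h1 : n ^ (3 / 2 : ℝ) = n * n ^ (1 / 2 : ℝ) := by
    nth_rewrite 2 [← Real.rpow_one n]
    rw [← Real.rpow_add_of_nonneg hn (by norm_num) (by norm_num)]; norm_num
  rw [h1, ← Real.sqrt_eq_rpow, ← Real.sqrt_eq_rpow]
  have hs := Real.sq_sqrt hu
  have ht := Real.sq_sqrt hn
  have : √n * √u ≤ (n + u) / 2 := by nlinarith [sq_nonneg (√n - √u)]
  nlinarith [mul_le_mul_of_nonneg_left this hn, sq_nonneg (n - u)]

theorem exists_norm_div_le {w : ℂ} (hw : 0 < w.re) :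
    ∃ C : ℝ, 0 < C ∧ ∀ (m : ℕ) (u : ℝ), 0 < u →
      ‖(u : ℂ) / ((u : ℂ) ^ 2 + poleParam w m ^ 2)‖
        ≤ C * ((m : ℝ) + 1) ^ (-(3 / 2) : ℝ) * u ^ (1 / 2 : ℝ) := by
  obtain ⟨C, hC, h⟩ := exists_sq_add_sq_le_norm hw
  refine ⟨C, hC, fun m u hu => ?_⟩
  have hm : (0 : ℝ) < (m : ℝ) + 1 := by positivity
  have hD := norm_pos_iff.mpr (sq_add_poleParam_sq_ne_zero hw m hu.le)
  have h1 := (rpow_mul_rpow_le_sq_add_sq hu.le hm.le).trans (h m u hu.le)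
  have h2 : u = u ^ (1 / 2 : ℝ) * u ^ (1 / 2 : ℝ) := by
    rw [← Real.rpow_add hu]; norm_num
  have hp : 0 < ((m : ℝ) + 1) ^ (3 / 2 : ℝ) := by positivity
  rw [norm_div, Complex.norm_real, Real.norm_of_nonneg hu.le, Real.rpow_neg hm.le,
    div_le_iff₀ hD]
  calc u = u ^ (1 / 2 : ℝ) * u ^ (1 / 2 : ℝ) := h2
    _ = (((m : ℝ) + 1) ^ (3 / 2 : ℝ))⁻¹ * u ^ (1 / 2 : ℝ)
        * (((m : ℝ) + 1) ^ (3 / 2 : ℝ) * u ^ (1 / 2 : ℝ)) := by field_simp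
    _ ≤ (((m : ℝ) + 1) ^ (3 / 2 : ℝ))⁻¹ * u ^ (1 / 2 : ℝ)
        * (C * ‖(u : ℂ) ^ 2 + poleParam w m ^ 2‖) := by gcongr
    _ = _ := by ring

theorem summable_succ_rpow : Summable fun m : ℕ => ((m : ℝ) + 1) ^ (-(3 / 2) : ℝ) := by
  have h := (Real.summable_nat_rpow (p := -(3 / 2))).mpr (by norm_num)
  have := (summable_nat_add_iff 1).mpr h
  simpa using this

/-- A crude bound, from the partial fraction expansion and `exists_norm_div_le`. -/
theorem exists_norm_binetKernel_le {w : ℂ} (hw : 0 < w.re) :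
    ∃ C : ℝ, 0 < C ∧ ∀ u : ℝ, 0 < u → ‖binetKernel w u‖ ≤ C * u ^ (1 / 2 : ℝ) := by
  obtain ⟨C, hC, h⟩ := exists_norm_div_le hw
  have hw0 : w ≠ 0 := by rintro rfl; simp at hw
  have hpos : 0 ≤ ∑' m : ℕ, ((m : ℝ) + 1) ^ (-(3 / 2) : ℝ) := tsum_nonneg fun m => by positivity
  refine ⟨2 * ‖w‖ * (C * ∑' m : ℕ, ((m : ℝ) + 1) ^ (-(3 / 2) : ℝ)) + 1, by positivity,
    fun u hu => ?_⟩
  have hs : HasSum (fun m : ℕ => C * ((m : ℝ) + 1) ^ (-(3 / 2) : ℝ) * u ^ (1 / 2 : ℝ))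
      (C * (∑' m : ℕ, ((m : ℝ) + 1) ^ (-(3 / 2) : ℝ)) * u ^ (1 / 2 : ℝ)) :=
    (summable_succ_rpow.hasSum.mul_left C).mul_right _
  have h1 := tsum_of_norm_bounded hs fun m => h m u hu
  rw [(hasSum_binetKernel hw hu).tsum_eq, norm_div] at h1
  have h2 : ‖(2 * w : ℂ)‖ = 2 * ‖w‖ := by simp
  have hw' : 0 < ‖w‖ := norm_pos_iff.mpr hw0
  rw [h2, div_le_iff₀ (by positivity)] at h1
  have : 0 ≤ u ^ (1 / 2 : ℝ) := by positivity
  nlinarith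

theorem exp_ofReal_div_sub_one_ne_zero {w : ℂ} (hw : 0 < w.re) {u : ℝ} (hu : 0 < u) :
    Complex.exp ((u : ℂ) / w) - 1 ≠ 0 := by
  have hw0 : w ≠ 0 := by rintro rfl; simp at hw
  intro h
  have h1 : ‖Complex.exp ((u : ℂ) / w)‖ = 1 := by rw [sub_eq_zero.mp h]; simp
  rw [Complex.norm_exp, Real.exp_eq_one_iff, Complex.div_re] at h1
  have : 0 < Complex.normSq w := Complex.normSq_pos.mpr hw0
  have h2 : 0 < u * w.re / Complex.normSq w := by positivity
  simp at h1
  rcases h1 with (h1 | h1) | h1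
  · exact hu.ne' h1
  · exact hw.ne' h1
  · exact hw0 h1

theorem continuousOn_binetKernel {w : ℂ} (hw : 0 < w.re) :
    ContinuousOn (binetKernel w) (Set.Ioi 0) := by
  unfold binetKernel
  refine ((ContinuousOn.div continuousOn_const (by fun_prop) fun u hu =>
    exp_ofReal_div_sub_one_ne_zero hw hu).sub (ContinuousOn.div continuousOn_const (by fun_prop)
      fun u (hu : 0 < u) => by exact_mod_cast hu.ne')).add continuousOn_const

theorem re_ofReal_div_nonneg {w : ℂ} (hw : 0 < w.re) {v : ℝ} (hv : 0 ≤ v) :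
    0 ≤ ((v : ℂ) / w).re := by
  rw [Complex.div_re]
  simp only [Complex.ofReal_re, Complex.ofReal_im, zero_mul, zero_div, add_zero]
  have := Complex.normSq_nonneg w
  positivity

theorem re_add_ofReal_div_pos {w c : ℂ} (hw : 0 < w.re) (hc : 0 < c.re) {v : ℝ} (hv : 0 ≤ v) :
    0 < (c + (v : ℂ) / w).re := by
  rw [Complex.add_re]
  linarith [re_ofReal_div_nonneg hw hv]

theorem norm_exp_neg_ofReal_div_mul_le_one {w : ℂ} (hw : 0 < w.re) {v u : ℝ} (hv : 0 ≤ v)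
    (hu : 0 ≤ u) : ‖Complex.exp (-((v : ℂ) / w * u))‖ ≤ 1 := by
  rw [norm_exp_neg_mul_ofReal, Real.exp_le_one_iff]
  nlinarith [mul_nonneg (re_ofReal_div_nonneg hw hv) hu]

/-- Frullani's integral for a logarithmic weight: averaging the Laplace transform over the shifts
`c + v / w`, `0 ≤ v ≤ N`. -/
theorem IsLogWeight.intervalIntegral_laplace {ω : ℝ → ℂ} (hω : IsLogWeight ω) {w c : ℂ}
    (hw : 0 < w.re) (hc : 0 < c.re) (N : ℕ) :
    ∫ v in (0 : ℝ)..N, ∫ u : ℝ in Set.Ioi 0, Complex.exp (-((c + (v : ℂ) / w) * u)) * ω u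
      = ∫ u : ℝ in Set.Ioi 0, Complex.exp (-(c * u)) * ω u *
          ((1 - Complex.exp (-((N : ℂ) / w * u))) * (w / u)) := by
  have hw0 : w ≠ 0 := by rintro rfl; simp at hw
  have hN : (0 : ℝ) ≤ N := Nat.cast_nonneg N
  rw [intervalIntegral_integral_swap]
  · refine setIntegral_congr_fun measurableSet_Ioi fun u hu => ?_
    have hu : 0 < u := hu
    have hu0 : (u : ℂ) ≠ 0 := by exact_mod_cast hu.ne'
    have e : ∀ v : ℝ, Complex.exp (-((c + (v : ℂ) / w) * u)) * ω u
        = Complex.exp (-(c * u)) * ω u * Complex.exp (-((u : ℂ) / w) * v) := by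
      intro v
      rw [show -((c + (v : ℂ) / w) * u) = -(c * u) + -((u : ℂ) / w) * v by ring, Complex.exp_add]
      ring
    simp_rw [e]
    rw [intervalIntegral.integral_const_mul, integral_exp_mul_complex
      (neg_ne_zero.mpr (div_ne_zero hu0 hw0))]
    congr 1
    simp only [Complex.ofReal_zero, mul_zero, Complex.exp_zero, Complex.ofReal_natCast]
    rw [show -((u : ℂ) / w) * N = -((N : ℂ) / w * u) by ring]
    field_simp
    ring
  · have h1 : Integrable (fun p : ℝ × ℝ => (1 : ℝ) * ‖Complex.exp (-(c * p.2)) * ω p.2‖)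
        ((volume.restrict (Set.uIoc (0 : ℝ) N)).prod (volume.restrict (Set.Ioi 0))) :=
      Integrable.mul_prod (f := fun _ : ℝ => (1 : ℝ))
        (by rw [Set.uIoc_of_le hN]; exact integrable_const _) (hω.integrableOn_exp hc).norm
    refine h1.mono' ?_ ?_
    · rw [Measure.prod_restrict]
      refine ContinuousOn.aestronglyMeasurable ?_ (measurableSet_uIoc.prod measurableSet_Ioi)
      refine ContinuousOn.mul (Continuous.continuousOn (by fun_prop)) ?_
      exact hω.1.comp continuousOn_snd fun p hp => hp.2
    · rw [Measure.prod_restrict]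
      filter_upwards [ae_restrict_mem (measurableSet_uIoc.prod measurableSet_Ioi)] with p hp
      rw [Set.uIoc_of_le hN] at hp
      have hv : 0 ≤ p.1 := hp.1.1.le
      have hu : 0 < p.2 := hp.2
      simp only [Function.uncurry]
      rw [show -((c + (p.1 : ℂ) / w) * p.2) = -((p.1 : ℂ) / w * p.2) + -(c * p.2) by ring,
        Complex.exp_add, mul_assoc, norm_mul]
      exact mul_le_mul_of_nonneg_right (norm_exp_neg_ofReal_div_mul_le_one hw hv hu.le)
        (norm_nonneg _)

/-- The Euler–Maclaurin defect `∑_{n=1}^N λ(n) - ∫_0^N λ + λ(0)/2` of the shifted Laplace transform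
`λ(v) = ∫_0^∞ e^{-(c + v/w)u} ω(u) du` tends to the Laplace integral against the Binet kernel. -/
theorem IsLogWeight.tendsto_sum_sub_integral {ω : ℝ → ℂ} (hω : IsLogWeight ω) {w c : ℂ}
    (hw : 0 < w.re) (hc : 0 < c.re) {lam : ℝ → ℂ}
    (hlam : ∀ v : ℝ, 0 ≤ v →
      ∫ u : ℝ in Set.Ioi 0, Complex.exp (-((c + (v : ℂ) / w) * u)) * ω u = lam v) :
    Tendsto (fun N : ℕ => ∑ n ∈ Finset.range N, lam ((n + 1 : ℕ) : ℝ)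
        - (∫ v in (0 : ℝ)..N, lam v) + lam 0 / 2) atTop
      (𝓝 (∫ u : ℝ in Set.Ioi 0, Complex.exp (-(c * u)) * ω u * binetKernel w u)) := by
  obtain ⟨B, hB, hK⟩ := exists_norm_binetKernel_le hw
  -- `F N` is `∑_{n ≤ N} e^{-nt} - (1 - e^{-Nt}) / t + 1 / 2` at `t = u / w`, in closed form.
  set F : ℕ → ℝ → ℂ := fun N u =>
    (1 - Complex.exp (-((N : ℂ) / w * u))) * (binetKernel w u - 1 / 2) + 1 / 2 with hF
  have hFb : ∀ N : ℕ, ∀ u : ℝ, 0 < u → ‖F N u‖ ≤ (2 * B + 2) * (1 + u ^ (1 / 2 : ℝ)) := by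
    intro N u hu
    have h1 : ‖1 - Complex.exp (-((N : ℂ) / w * u))‖ ≤ 2 := by
      refine (norm_sub_le _ _).trans ?_
      have := norm_exp_neg_ofReal_div_mul_le_one hw (Nat.cast_nonneg N) hu.le
      rw [Complex.ofReal_natCast] at this
      rw [norm_one]; linarith
    have h2 : ‖binetKernel w u - 1 / 2‖ ≤ B * u ^ (1 / 2 : ℝ) + 1 / 2 := by
      refine (norm_sub_le _ _).trans (add_le_add (hK u hu) (by simp))
    have h3 : 0 ≤ u ^ (1 / 2 : ℝ) := by positivity
    calc ‖F N u‖ ≤ 2 * (B * u ^ (1 / 2 : ℝ) + 1 / 2) + 1 / 2 := by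
          refine (norm_add_le _ _).trans (add_le_add ?_ (by simp))
          rw [norm_mul]
          exact mul_le_mul h1 h2 (norm_nonneg _) (by norm_num)
      _ ≤ _ := by nlinarith [mul_nonneg hB.le h3]
  have hFm : ∀ N : ℕ, AEStronglyMeasurable (F N) (volume.restrict (Set.Ioi 0)) := fun N =>
    (((Continuous.continuousOn (by fun_prop)).mul ((continuousOn_binetKernel hw).sub
      continuousOn_const)).add continuousOn_const).aestronglyMeasurable measurableSet_Ioi
  have hlim : Tendsto (fun N : ℕ => ∫ u : ℝ in Set.Ioi 0, Complex.exp (-(c * u)) * ω u * F N u)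
      atTop (𝓝 (∫ u : ℝ in Set.Ioi 0, Complex.exp (-(c * u)) * ω u * binetKernel w u)) := by
    obtain ⟨C, hC, hb⟩ := hω.2
    refine tendsto_integral_of_dominated_convergence _
      (fun N => (hω.integrableOn_exp_mul hc (hFm N) (hFb N)).aestronglyMeasurable)
      ((integrableOn_exp_mul_logWeight_bound hc).const_mul (C * (2 * B + 2))) (fun N => ?_) ?_
    · filter_upwards [ae_restrict_mem measurableSet_Ioi] with u hu
      have hu : 0 < u := hu
      rw [norm_mul, norm_mul, norm_exp_neg_mul_ofReal]
      calc _ ≤ Real.exp (-c.re * u) * (C * (u ^ (1 / 4 : ℝ) + u ^ (-(1 / 4) : ℝ)))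
            * ((2 * B + 2) * (1 + u ^ (1 / 2 : ℝ))) := by
            have := hb u hu
            have := hFb N u hu
            gcongr
        _ = _ := by ring
    · filter_upwards [ae_restrict_mem measurableSet_Ioi] with u hu
      have hu : 0 < u := hu
      refine Tendsto.mul tendsto_const_nhds ?_
      have hz : ‖Complex.exp (-(1 / w * u))‖ < 1 := by
        rw [norm_exp_neg_mul_ofReal, Real.exp_lt_one_iff]
        have h1 : 0 < (1 / w).re := by
          rw [one_div, Complex.inv_re]
          exact div_pos hw (Complex.normSq_pos.mpr (by rintro rfl; simp at hw))
        nlinarith [mul_pos h1 hu]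
      have hpow := tendsto_pow_atTop_nhds_zero_of_norm_lt_one hz
      have : Tendsto (fun N : ℕ => F N u) atTop
          (𝓝 ((1 - 0) * (binetKernel w u - 1 / 2) + 1 / 2)) := by
        refine ((Tendsto.sub tendsto_const_nhds ?_).mul_const _).add_const _
        refine hpow.congr fun N => ?_
        rw [← Complex.exp_nat_mul]
        congr 1; ring
      simpa using this
  refine hlim.congr fun N => ?_
  have hint : ∀ v : ℝ, 0 ≤ v →
      IntegrableOn (fun u : ℝ => Complex.exp (-((c + (v : ℂ) / w) * u)) * ω u) (Set.Ioi 0) :=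
    fun v hv => hω.integrableOn_exp (re_add_ofReal_div_pos hw hc hv)
  have hI : ∫ v in (0 : ℝ)..N, lam v = ∫ u : ℝ in Set.Ioi 0, Complex.exp (-(c * u)) * ω u *
      ((1 - Complex.exp (-((N : ℂ) / w * u))) * (w / u)) := by
    rw [← hω.intervalIntegral_laplace hw hc N]
    refine intervalIntegral.integral_congr fun v hv => ?_
    rw [Set.uIcc_of_le (Nat.cast_nonneg N)] at hv
    exact (hlam v hv.1).symm
  have hS : ∑ n ∈ Finset.range N, lam ((n + 1 : ℕ) : ℝ) = ∫ u : ℝ in Set.Ioi 0,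
      ∑ n ∈ Finset.range N, Complex.exp (-((c + (((n + 1 : ℕ) : ℝ) : ℂ) / w) * u)) * ω u := by
    rw [integral_finsetSum _ fun n _ => hint _ (Nat.cast_nonneg _)]
    exact Finset.sum_congr rfl fun n _ => (hlam _ (Nat.cast_nonneg _)).symm
  have h0 : lam 0 / 2 = ∫ u : ℝ in Set.Ioi 0, Complex.exp (-(c * u)) * ω u / 2 := by
    rw [← hlam 0 le_rfl, integral_div]; simp
  have hpt : ∀ u ∈ Set.Ioi (0 : ℝ), Complex.exp (-(c * u)) * ω u *
      ((1 - Complex.exp (-((N : ℂ) / w * u))) * (w / u))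
      = (∑ n ∈ Finset.range N, Complex.exp (-((c + (((n + 1 : ℕ) : ℝ) : ℂ) / w) * u)) * ω u)
        + Complex.exp (-(c * u)) * ω u / 2 - Complex.exp (-(c * u)) * ω u * F N u := by
    intro u hu
    have hE := exp_ofReal_div_sub_one_ne_zero hw hu
    have hE0 := Complex.exp_ne_zero ((u : ℂ) / w)
    have hterm : ∀ n : ℕ, Complex.exp (-((c + (((n + 1 : ℕ) : ℝ) : ℂ) / w) * u)) * ω u
        = Complex.exp (-(c * u)) * ω u * (Complex.exp ((u : ℂ) / w))⁻¹
          * (Complex.exp ((u : ℂ) / w))⁻¹ ^ n := by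
      intro n
      rw [← Complex.exp_neg, ← Complex.exp_nat_mul]
      rw [show -((c + (((n + 1 : ℕ) : ℝ) : ℂ) / w) * u)
        = -(c * u) + -((u : ℂ) / w) + n * -((u : ℂ) / w) by push_cast; ring,
        Complex.exp_add, Complex.exp_add]
      ring
    have hq : (Complex.exp ((u : ℂ) / w))⁻¹ ≠ 1 := by
      intro h
      exact hE (sub_eq_zero.mpr (inv_eq_one.mp h))
    simp_rw [hterm]
    rw [← Finset.mul_sum, geom_sum_eq hq]
    have hN : Complex.exp (-((N : ℂ) / w * u)) = (Complex.exp ((u : ℂ) / w))⁻¹ ^ N := by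
      rw [← Complex.exp_neg, ← Complex.exp_nat_mul]
      congr 1; ring
    simp only [hF, binetKernel]
    rw [hN]
    generalize (Complex.exp ((u : ℂ) / w))⁻¹ ^ N = Q at *
    generalize Complex.exp ((u : ℂ) / w) = E at *
    have hq' : E⁻¹ - 1 ≠ 0 := sub_ne_zero.mpr hq
    have : E⁻¹ * ((Q - 1) / (E⁻¹ - 1)) = (1 - Q) * (1 / (E - 1)) := by
      have : E⁻¹ - 1 = -(E - 1) / E := by field_simp; ring
      rw [this]
      field_simp
      ring
    linear_combination (-(Complex.exp (-(c * u)) * ω u)) * this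
  have hSi : IntegrableOn (fun u : ℝ => ∑ n ∈ Finset.range N,
      Complex.exp (-((c + (((n + 1 : ℕ) : ℝ) : ℂ) / w) * u)) * ω u) (Set.Ioi 0) :=
    integrable_finsetSum _ fun n _ => hint _ (Nat.cast_nonneg _)
  have hhi : IntegrableOn (fun u : ℝ => Complex.exp (-(c * u)) * ω u / 2) (Set.Ioi 0) :=
    (hω.integrableOn_exp hc).div_const 2
  have hadd : IntegrableOn (fun u : ℝ => (∑ n ∈ Finset.range N,
      Complex.exp (-((c + (((n + 1 : ℕ) : ℝ) : ℂ) / w) * u)) * ω u)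
        + Complex.exp (-(c * u)) * ω u / 2) (Set.Ioi 0) := hSi.add hhi
  rw [hI, setIntegral_congr_fun measurableSet_Ioi hpt,
    integral_sub hadd (hω.integrableOn_exp_mul hc (hFm N) (hFb N)),
    integral_add hSi hhi, hS, h0]
  ring

/-! ### The digamma function as a limit -/

/-- Termwise differentiation of the Weierstrass series for `log Γ`. The half-plane `-1/2 < re z` is
used because it contains `0`, where all terms vanish. -/
theorem hasDerivAt_tsum_div_sub_log {z : ℂ} (hz : -(1 / 2) < z.re) :
    (Summable fun n : ℕ => z / (n + 1) - Complex.log (1 + z / (n + 1))) ∧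
    (Summable fun n : ℕ => 1 / ((n : ℂ) + 1) - 1 / ((n : ℂ) + 1 + z)) ∧
    HasDerivAt (fun y : ℂ => ∑' n : ℕ, (y / (n + 1) - Complex.log (1 + y / (n + 1))))
      (∑' n : ℕ, (1 / ((n : ℂ) + 1) - 1 / ((n : ℂ) + 1 + z))) z := by
  set R : ℝ := ‖z‖ + 1 with hR
  set t : Set ℂ := {y : ℂ | -(1 / 2) < y.re} ∩ Metric.ball 0 R with ht
  have hto : IsOpen t :=
    (isOpen_lt continuous_const Complex.continuous_re).inter Metric.isOpen_ball
  have htc : IsPreconnected t :=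
    ((convex_halfSpace_re_gt _).inter (convex_ball _ _)).isPreconnected
  have h0t : (0 : ℂ) ∈ t := ⟨by simp, Metric.mem_ball_self (by positivity)⟩
  have hzt : z ∈ t := ⟨hz, by simp [hR]⟩
  have hre : ∀ (n : ℕ) (y : ℂ), y ∈ t → ((n : ℝ) + 1) / 2 ≤ ((n : ℂ) + 1 + y).re := by
    intro n y hy
    have h1 : -(1 / 2) < y.re := hy.1
    have : (0 : ℝ) ≤ n := Nat.cast_nonneg n
    simp
    linarith
  have hne : ∀ (n : ℕ) (y : ℂ), y ∈ t → (n : ℂ) + 1 + y ≠ 0 := by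
    intro n y hy h
    have h1 := hre n y hy
    rw [h] at h1
    have : (0 : ℝ) ≤ n := Nat.cast_nonneg n
    simp at h1
    linarith
  have hn1 : ∀ n : ℕ, (n : ℂ) + 1 ≠ 0 := fun n => Nat.cast_add_one_ne_zero n
  have hu : Summable fun n : ℕ => 2 * R * (1 / ((n : ℝ) + 1) ^ 2) := by
    have h := (Real.summable_one_div_nat_pow (p := 2)).mpr one_lt_two
    have := (summable_nat_add_iff 1).mpr h
    exact (by simpa using this : Summable fun n : ℕ => 1 / ((n : ℝ) + 1) ^ 2).mul_left _
  have hd : ∀ (n : ℕ) (y : ℂ), y ∈ t → HasDerivAt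
      (fun y : ℂ => y / ((n : ℂ) + 1) - Complex.log (1 + y / ((n : ℂ) + 1)))
      (1 / ((n : ℂ) + 1) - 1 / ((n : ℂ) + 1 + y)) y := by
    intro n y hy
    have hsl : 1 + y / ((n : ℂ) + 1) ∈ Complex.slitPlane := by
      have e : 1 + y / ((n : ℂ) + 1) = (((n : ℝ) + 1)⁻¹ : ℝ) * ((n : ℂ) + 1 + y) := by
        have := hn1 n
        push_cast
        field_simp
      left
      rw [e, Complex.re_ofReal_mul]
      have := hre n y hy
      have h2 : (0 : ℝ) < (n : ℝ) + 1 := by positivity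
      have h3 : 0 < ((n : ℂ) + 1 + y).re := by linarith
      positivity
    have h1 : HasDerivAt (fun y : ℂ => y / ((n : ℂ) + 1)) (1 / ((n : ℂ) + 1)) y :=
      (hasDerivAt_id y).div_const _
    refine (h1.sub ((h1.const_add 1).clog hsl)).congr_deriv ?_
    have a := hn1 n
    have b := hne n y hy
    have c : 1 + y / ((n : ℂ) + 1) ≠ 0 := Complex.slitPlane_ne_zero hsl
    have e : 1 + y / ((n : ℂ) + 1) = ((n : ℂ) + 1 + y) / ((n : ℂ) + 1) := by field_simp
    rw [e]
    field_simp
  have hb : ∀ (n : ℕ) (y : ℂ), y ∈ t →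
      ‖1 / ((n : ℂ) + 1) - 1 / ((n : ℂ) + 1 + y)‖ ≤ 2 * R * (1 / ((n : ℝ) + 1) ^ 2) := by
    intro n y hy
    have a := hn1 n
    have b := hne n y hy
    have e : 1 / ((n : ℂ) + 1) - 1 / ((n : ℂ) + 1 + y)
        = y / (((n : ℂ) + 1) * ((n : ℂ) + 1 + y)) := by
      field_simp
      ring
    have h1 : ‖(n : ℂ) + 1‖ = (n : ℝ) + 1 := by
      have := Complex.norm_natCast (n + 1)
      push_cast at this
      exact this
    have h2 : ((n : ℝ) + 1) / 2 ≤ ‖(n : ℂ) + 1 + y‖ :=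
      (hre n y hy).trans (Complex.re_le_norm _)
    have h3 : ‖y‖ ≤ R := by have := hy.2; rw [mem_ball_zero_iff] at this; exact this.le
    have h4 : (0 : ℝ) < (n : ℝ) + 1 := by positivity
    rw [e, norm_div, norm_mul, h1]
    calc ‖y‖ / (((n : ℝ) + 1) * ‖(n : ℂ) + 1 + y‖)
        ≤ R / (((n : ℝ) + 1) * (((n : ℝ) + 1) / 2)) := by gcongr
      _ = _ := by field_simp
  have hs0 : Summable fun n : ℕ =>
      (0 : ℂ) / ((n : ℂ) + 1) - Complex.log (1 + 0 / ((n : ℂ) + 1)) := by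
    simp
  refine ⟨?_, .of_norm_bounded hu fun n => hb n z hzt, ?_⟩
  · exact summable_of_summable_hasDerivAt_of_isPreconnected
      (g := fun (n : ℕ) (y : ℂ) => y / ((n : ℂ) + 1) - Complex.log (1 + y / ((n : ℂ) + 1)))
      (g' := fun (n : ℕ) (y : ℂ) => 1 / ((n : ℂ) + 1) - 1 / ((n : ℂ) + 1 + y))
      hu hto htc hd hb h0t hs0 hzt
  · exact hasDerivAt_tsum_of_isPreconnected
      (g := fun (n : ℕ) (y : ℂ) => y / ((n : ℂ) + 1) - Complex.log (1 + y / ((n : ℂ) + 1)))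
      (g' := fun (n : ℕ) (y : ℂ) => 1 / ((n : ℂ) + 1) - 1 / ((n : ℂ) + 1 + y))
      hu hto htc hd hb h0t hs0 hzt

/-- Weierstrass' product for the Gamma function, in logarithmic form. -/
theorem exp_tsum_div_sub_log {z : ℂ} (hz : 0 < z.re) :
    Complex.exp (∑' n : ℕ, (z / (n + 1) - Complex.log (1 + z / (n + 1))))
      = Complex.exp ((Real.eulerMascheroniConstant : ℂ) * z) * (z * Complex.Gamma z) := by
  have hsum := (hasDerivAt_tsum_div_sub_log (z := z) (by linarith)).1.hasSum.tendsto_sum_nat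
  have h1 := (Complex.continuous_exp.tendsto _).comp hsum
  have h2 : Tendsto (fun N : ℕ => Complex.exp (((harmonic N - Real.log N : ℝ) : ℂ) * z)
      * (z * Complex.GammaSeq z N)) atTop
      (𝓝 (Complex.exp ((Real.eulerMascheroniConstant : ℂ) * z) * (z * Complex.Gamma z))) := by
    refine Tendsto.mul ?_ ((Complex.GammaSeq_tendsto_Gamma z).const_mul z)
    refine (Complex.continuous_exp.tendsto _).comp (Tendsto.mul_const z ?_)
    exact (Complex.continuous_ofReal.tendsto _).comp Real.tendsto_harmonic_sub_log
  refine tendsto_nhds_unique h1 (h2.congr' ?_)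
  filter_upwards [eventually_ge_atTop 1] with N hN
  have hN0 : (N : ℂ) ≠ 0 := by exact_mod_cast (by omega : N ≠ 0)
  have hz0 : z ≠ 0 := by rintro rfl; simp at hz
  have hne : ∀ n : ℕ, (n : ℂ) + 1 + z ≠ 0 := by
    intro n h
    have := congrArg Complex.re h
    simp at this
    have : (0 : ℝ) ≤ n := Nat.cast_nonneg n
    linarith
  have hn1 : ∀ n : ℕ, (n : ℂ) + 1 ≠ 0 := fun n => Nat.cast_add_one_ne_zero n
  have hne' : ∀ n : ℕ, 1 + z / ((n : ℂ) + 1) ≠ 0 := by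
    intro n h
    apply hne n
    have := hn1 n
    field_simp at h
    simpa using h
  have hprod : ∏ j ∈ Finset.range (N + 1), (z + (j : ℂ))
      = z * ((Nat.factorial N : ℂ) * ∏ n ∈ Finset.range N, (1 + z / ((n : ℂ) + 1))) := by
    rw [Finset.prod_range_succ', Nat.cast_zero, add_zero, mul_comm]
    congr 1
    rw [← Finset.prod_range_add_one_eq_factorial]
    push_cast
    rw [← Finset.prod_mul_distrib]
    refine Finset.prod_congr rfl fun n _ => ?_
    have := hn1 n
    field_simp
    ring
  have hP : ∏ n ∈ Finset.range N, (1 + z / ((n : ℂ) + 1)) ≠ 0 :=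
    Finset.prod_ne_zero_iff.mpr fun n _ => hne' n
  have hfac : (Nat.factorial N : ℂ) ≠ 0 := by exact_mod_cast Nat.factorial_ne_zero N
  have hH : ((harmonic N : ℝ) : ℂ) = ∑ n ∈ Finset.range N, 1 / ((n : ℂ) + 1) := by
    simp [harmonic]
  have hpow : (N : ℂ) ^ z = Complex.exp ((Real.log N : ℂ) * z) := by
    rw [Complex.cpow_def_of_ne_zero hN0, Complex.natCast_log]
  have hexp : Complex.exp (∑ n ∈ Finset.range N, (z / ((n : ℂ) + 1)
      - Complex.log (1 + z / ((n : ℂ) + 1))))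
      = Complex.exp (((harmonic N : ℝ) : ℂ) * z)
        / ∏ n ∈ Finset.range N, (1 + z / ((n : ℂ) + 1)) := by
    rw [Finset.sum_sub_distrib, Complex.exp_sub, Complex.exp_sum (f := fun n : ℕ =>
      Complex.log (1 + z / ((n : ℂ) + 1))), hH, Finset.sum_mul]
    congr 1
    · congr 1
      exact Finset.sum_congr rfl fun n _ => by ring
    · exact Finset.prod_congr rfl fun n _ => Complex.exp_log (hne' n)
  simp only [Function.comp]
  rw [hexp, Complex.GammaSeq, hprod, hpow, Complex.ofReal_sub, sub_mul, Complex.exp_sub]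
  have := Complex.exp_ne_zero ((Real.log N : ℂ) * z)
  field_simp

theorem digamma_eq_tsum {z : ℂ} (hz : 0 < z.re) :
    Complex.digamma z = -(Real.eulerMascheroniConstant : ℂ) - 1 / z
      + ∑' n : ℕ, (1 / ((n : ℂ) + 1) - 1 / ((n : ℂ) + 1 + z)) := by
  have hz0 : z ≠ 0 := by rintro rfl; simp at hz
  have hd := (hasDerivAt_tsum_div_sub_log (z := z) (by linarith)).2.2
  set G : ℂ → ℂ := fun y => ∑' n : ℕ, (y / (n + 1) - Complex.log (1 + y / (n + 1))) with hG
  set g : ℂ := (Real.eulerMascheroniConstant : ℂ) with hg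
  have hU : {s : ℂ | 0 < s.re} ∈ 𝓝 z :=
    (isOpen_lt continuous_const Complex.continuous_re).mem_nhds hz
  have hev : Complex.Gamma =ᶠ[𝓝 z] fun y => Complex.exp (G y - g * y) / y := by
    filter_upwards [hU] with y hy
    have hy0 : y ≠ 0 := by rintro rfl; simp at hy
    rw [Complex.exp_sub, hG, exp_tsum_div_sub_log hy, ← hg]
    have := Complex.exp_ne_zero (g * y)
    field_simp
  have hg1 : HasDerivAt (fun y : ℂ => g * y) g z := by
    simpa using (hasDerivAt_id z).const_mul g
  have hder := (((hd.sub hg1).cexp).div (hasDerivAt_id z) hz0).congr_of_eventuallyEq hev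
  rw [Complex.digamma_def, logDeriv_apply, hder.deriv, hev.eq_of_nhds]
  have := Complex.exp_ne_zero (G z - g * z)
  simp only [id, Pi.sub_apply]
  field_simp
  ring

theorem tendsto_log_sub_sum_of_re_pos {z : ℂ} (hz : 0 < z.re) :
    Tendsto (fun N : ℕ => (Real.log N : ℂ) - ∑ n ∈ Finset.range (N + 1), 1 / (z + n)) atTop
      (𝓝 (Complex.digamma z)) := by
  have hs := (hasDerivAt_tsum_div_sub_log (z := z) (by linarith)).2.1.hasSum.tendsto_sum_nat
  have hγ := (Complex.continuous_ofReal.tendsto _).comp Real.tendsto_harmonic_sub_log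
  rw [digamma_eq_tsum hz]
  refine ((hγ.neg.sub_const (1 / z)).add hs).congr fun N => ?_
  have hH : ((harmonic N : ℝ) : ℂ) = ∑ n ∈ Finset.range N, 1 / ((n : ℂ) + 1) := by
    simp [harmonic]
  rw [Finset.sum_range_succ', Finset.sum_sub_distrib, ← hH]
  simp only [Function.comp]
  have : ∑ n ∈ Finset.range N, 1 / (z + ((n + 1 : ℕ) : ℂ))
      = ∑ n ∈ Finset.range N, 1 / ((n : ℂ) + 1 + z) :=
    Finset.sum_congr rfl fun n _ => by push_cast; ring_nf
  rw [this]
  push_cast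
  ring

/-- The digamma function as a limit of partial sums; the recurrence carries the half-plane
`0 < re z` to all of its domain. -/
theorem tendsto_log_sub_sum_digamma {z : ℂ} (hz : ∀ m : ℕ, z ≠ -m) :
    Tendsto (fun N : ℕ => (Real.log N : ℂ) - ∑ n ∈ Finset.range (N + 1), 1 / (z + n)) atTop
      (𝓝 (Complex.digamma z)) := by
  obtain ⟨k, hk⟩ := exists_nat_gt (-z.re)
  have key : ∀ (k : ℕ) (z : ℂ), (∀ m : ℕ, z ≠ -m) → -z.re < k →
      Tendsto (fun N : ℕ => (Real.log N : ℂ) - ∑ n ∈ Finset.range (N + 1), 1 / (z + n)) atTop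
        (𝓝 (Complex.digamma z)) := by
    intro k
    induction k with
    | zero => intro z _ h; exact tendsto_log_sub_sum_of_re_pos (by simpa using h)
    | succ k ih =>
      intro z hz h
      have hz' : ∀ m : ℕ, z + 1 ≠ -m := by
        intro m hm
        apply hz (m + 1)
        push_cast
        linear_combination hm
      have h1 := ih (z + 1) hz' (by push_cast at h; simp; linarith)
      rw [Complex.digamma_apply_add_one z hz] at h1
      have h2 : Tendsto (fun N : ℕ => 1 / (z + ((N + 1 : ℕ) : ℂ))) atTop (𝓝 0) := by
        simp_rw [one_div]
        refine tendsto_inv₀_cobounded.comp ?_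
        refine tendsto_const_add_cobounded z |>.comp ?_
        exact (RCLike.tendsto_ofReal_atTop_cobounded ℂ).comp
          (tendsto_natCast_atTop_atTop.comp (tendsto_add_atTop_nat 1))
      have h3 := (h1.sub_const (z⁻¹)).add h2
      rw [add_zero, add_sub_cancel_right] at h3
      refine h3.congr fun N => ?_
      have e1 := Finset.sum_range_succ (fun n : ℕ => 1 / (z + (n : ℂ))) (N + 1)
      have e2 := Finset.sum_range_succ' (fun n : ℕ => 1 / (z + (n : ℂ))) (N + 1)
      have e3 : ∑ n ∈ Finset.range (N + 1), 1 / (z + 1 + (n : ℂ))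
          = ∑ n ∈ Finset.range (N + 1), 1 / (z + ((n + 1 : ℕ) : ℂ)) :=
        Finset.sum_congr rfl fun n _ => by push_cast; ring_nf
      rw [e3]
      rw [e1] at e2
      simp only [Nat.cast_zero, add_zero, one_div] at e2 ⊢
      linear_combination e2
  exact key k z hz hk

theorem ne_neg_natCast_of_mem_slitPlane {z : ℂ} (hz : z ∈ Complex.slitPlane) (m : ℕ) :
    z ≠ -m := by
  rintro rfl
  rcases hz with h | h
  · simp at h
    have : (0 : ℝ) ≤ m := Nat.cast_nonneg m
    linarith
  · simp at h

theorem continuousAt_digamma {z : ℂ} (hz : z ∈ Complex.slitPlane) :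
    ContinuousAt Complex.digamma z := by
  have hd : DifferentiableOn ℂ Complex.Gamma Complex.slitPlane := fun y hy =>
    (Complex.differentiableAt_Gamma y (ne_neg_natCast_of_mem_slitPlane hy)).differentiableWithinAt
  have ha := hd.analyticAt (Complex.isOpen_slitPlane.mem_nhds hz)
  exact ha.deriv.continuousAt.div ha.continuousAt
    (Complex.Gamma_ne_zero (ne_neg_natCast_of_mem_slitPlane hz))

/-! ### The function `psiOne` and the Binet-type formula -/

theorem norm_natCast_add_one (n : ℕ) : ‖(n : ℂ) + 1‖ = (n : ℝ) + 1 := by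
  have := Complex.norm_natCast (n + 1)
  push_cast at this
  exact this

theorem log_natCast_succ_add {z : ℂ} {n : ℕ} (hz : ‖z‖ ≤ ((n : ℝ) + 1) / 2) :
    Complex.log (((n + 1 : ℕ) : ℂ) + z)
      = (Real.log ((n : ℝ) + 1) : ℂ) + Complex.log (1 + z / ((n : ℂ) + 1)) := by
  have hn : (0 : ℝ) < (n : ℝ) + 1 := by positivity
  have hn0 : (n : ℂ) + 1 ≠ 0 := Nat.cast_add_one_ne_zero n
  have hne : 1 + z / ((n : ℂ) + 1) ≠ 0 := by
    intro h
    have h1 : z / ((n : ℂ) + 1) = -1 := by linear_combination h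
    have h2 : ‖z / ((n : ℂ) + 1)‖ = 1 := by rw [h1]; simp
    rw [norm_div, norm_natCast_add_one, div_eq_one_iff_eq hn.ne'] at h2
    linarith
  rw [← Complex.log_ofReal_mul hn hne]
  congr 1
  push_cast
  field_simp

theorem norm_log_one_add_div_le {z : ℂ} {n : ℕ} (hz : ‖z‖ ≤ ((n : ℝ) + 1) / 2) :
    ‖Complex.log (1 + z / ((n : ℂ) + 1))‖ ≤ 3 / 2 * ‖z‖ / ((n : ℝ) + 1) := by
  have hn : (0 : ℝ) < (n : ℝ) + 1 := by positivity
  have h : ‖z / ((n : ℂ) + 1)‖ ≤ 1 / 2 := by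
    rw [norm_div, norm_natCast_add_one, div_le_iff₀ hn]; linarith
  refine (Complex.norm_log_one_add_half_le_self h).trans (le_of_eq ?_)
  rw [norm_div, norm_natCast_add_one]
  ring

/-- The terms of the series defining `psiOne`. -/
noncomputable def psiOneTerm (z : ℂ) (n : ℕ) : ℂ :=
  Complex.log (((n + 1 : ℕ) : ℂ) + z) / (((n + 1 : ℕ) : ℂ) + z)
    - Complex.log ((n + 1 : ℕ) : ℂ) / ((n + 1 : ℕ) : ℂ)

/-- Writing `log (n + z) = log n + log (1 + z/n)`, the terms are `O(log n / n²)`. -/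
theorem norm_psiOneTerm_le {z : ℂ} {n : ℕ} (hz : ‖z‖ ≤ ((n : ℝ) + 1) / 2) :
    ‖psiOneTerm z n‖ ≤ 7 * ‖z‖ * ((n : ℝ) + 1) ^ (-(3 / 2) : ℝ) := by
  have hn : (0 : ℝ) < (n : ℝ) + 1 := by positivity
  have hn1 : (1 : ℝ) ≤ (n : ℝ) + 1 := by have := Nat.cast_nonneg (α := ℝ) n; linarith
  have hn0 : (n : ℂ) + 1 ≠ 0 := Nat.cast_add_one_ne_zero n
  have hlow : ((n : ℝ) + 1) / 2 ≤ ‖(n : ℂ) + 1 + z‖ := by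
    have := norm_sub_le ((n : ℂ) + 1 + z) z
    rw [add_sub_cancel_right, norm_natCast_add_one] at this
    linarith
  have hne : (n : ℂ) + 1 + z ≠ 0 := by
    intro h; rw [h, norm_zero] at hlow; linarith
  have hlog : Complex.log ((n : ℂ) + 1) = (Real.log ((n : ℝ) + 1) : ℂ) := by
    rw [Complex.ofReal_log hn.le]; push_cast; rfl
  have e : psiOneTerm z n = (((n : ℂ) + 1) * Complex.log (1 + z / ((n : ℂ) + 1))
      - z * (Real.log ((n : ℝ) + 1) : ℂ)) / (((n : ℂ) + 1) * ((n : ℂ) + 1 + z)) := by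
    rw [psiOneTerm, log_natCast_succ_add hz]
    push_cast
    rw [hlog]
    field_simp
    ring
  set k : ℝ := (n : ℝ) + 1 with hk
  have hl0 : 0 ≤ Real.log k := Real.log_nonneg hn1
  have hl : Real.log k ≤ 2 * k ^ (1 / 2 : ℝ) := by
    have := Real.log_le_rpow_div hn.le (show (0 : ℝ) < 1 / 2 by norm_num)
    linarith
  have h1k : 1 ≤ k ^ (1 / 2 : ℝ) := Real.one_le_rpow hn1 (by norm_num)
  have hnum : ‖((n : ℂ) + 1) * Complex.log (1 + z / ((n : ℂ) + 1))
      - z * (Real.log k : ℂ)‖ ≤ 7 / 2 * ‖z‖ * k ^ (1 / 2 : ℝ) := by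
    refine (norm_sub_le _ _).trans ?_
    rw [norm_mul, norm_mul, norm_natCast_add_one, Complex.norm_real, Real.norm_of_nonneg hl0]
    have h1 : k * ‖Complex.log (1 + z / ((n : ℂ) + 1))‖ ≤ 3 / 2 * ‖z‖ := by
      have := mul_le_mul_of_nonneg_left (norm_log_one_add_div_le hz) hn.le
      refine this.trans (le_of_eq ?_)
      rw [← hk]
      field_simp
    have h2 : ‖z‖ * Real.log k ≤ ‖z‖ * (2 * k ^ (1 / 2 : ℝ)) := by gcongr
    nlinarith [norm_nonneg z]
  have hkk : k ^ (-(3 / 2) : ℝ) = k ^ (1 / 2 : ℝ) / (k * k) := by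
    rw [show (-(3 / 2) : ℝ) = 1 / 2 - 2 by norm_num, Real.rpow_sub hn]
    norm_num
    ring
  rw [e, norm_div, norm_mul, norm_natCast_add_one, ← hk, hkk]
  calc _ ≤ (7 / 2 * ‖z‖ * k ^ (1 / 2 : ℝ)) / (k * (k / 2)) := by gcongr
    _ = _ := by field_simp

theorem summable_psiOneTerm (z : ℂ) : Summable (psiOneTerm z) := by
  refine Summable.of_norm_bounded_eventually_nat (summable_succ_rpow.mul_left (7 * ‖z‖)) ?_
  filter_upwards [tendsto_natCast_atTop_atTop.eventually (eventually_ge_atTop (2 * ‖z‖))] with n hn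
  exact norm_psiOneTerm_le (by linarith)

theorem add_ofReal_mem_slitPlane {z : ℂ} (hz : z ∈ Complex.slitPlane) {v : ℝ} (hv : 0 ≤ v) :
    z + (v : ℂ) ∈ Complex.slitPlane := by
  rcases hz with h | h
  · left; simp; linarith
  · right; simpa using h

theorem continuousAt_psiOne {z : ℂ} (hz : z ∈ Complex.slitPlane) : ContinuousAt psiOne z := by
  -- Beyond `N` the bound `norm_psiOneTerm_le` applies on the whole unit ball around `z`.
  obtain ⟨N, hN⟩ := exists_nat_ge (2 * (‖z‖ + 1))
  have hlog : ContinuousAt (fun y : ℂ => Complex.log y / y) z :=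
    (continuousAt_clog hz).div continuousAt_id (Complex.slitPlane_ne_zero hz)
  have hfin : ∀ n : ℕ, ContinuousAt (fun y => psiOneTerm y n) z := by
    intro n
    have hs : ((n + 1 : ℕ) : ℂ) + z ∈ Complex.slitPlane := by
      have := add_ofReal_mem_slitPlane hz (v := ((n + 1 : ℕ) : ℝ)) (Nat.cast_nonneg _)
      rwa [add_comm, Complex.ofReal_natCast] at this
    have ha : ContinuousAt (fun y : ℂ => ((n + 1 : ℕ) : ℂ) + y) z := by fun_prop
    exact ((ha.clog hs).div ha (Complex.slitPlane_ne_zero hs)).sub continuousAt_const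
  have htail : Tendsto (fun y => ∑' n : ℕ, psiOneTerm y (n + N)) (𝓝 z)
      (𝓝 (∑' n : ℕ, psiOneTerm z (n + N))) := by
    refine tendsto_tsum_of_dominated_convergence
      (bound := fun n : ℕ => 7 * (‖z‖ + 1) * (((n + N : ℕ) : ℝ) + 1) ^ (-(3 / 2) : ℝ)) ?_
      (fun n => hfin (n + N)) ?_
    · exact ((summable_nat_add_iff N).mpr summable_succ_rpow).mul_left (7 * (‖z‖ + 1))
    · filter_upwards [Metric.ball_mem_nhds z one_pos] with y hy n
      have hy' : ‖y‖ ≤ ‖z‖ + 1 := by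
        rw [mem_ball_iff_norm] at hy
        have := norm_add_le (y - z) z
        rw [sub_add_cancel] at this
        linarith
      refine (norm_psiOneTerm_le ?_).trans (by gcongr)
      push_cast
      have := Nat.cast_nonneg (α := ℝ) n
      linarith
  have hsum : ∀ y : ℂ, psiOne y = -(stieltjesGammaOne : ℂ) - Complex.log y / y
      - (∑ n ∈ Finset.range N, psiOneTerm y n + ∑' n : ℕ, psiOneTerm y (n + N)) := by
    intro y
    rw [(summable_psiOneTerm y).sum_add_tsum_nat_add N]
    rfl
  rw [ContinuousAt, hsum z, funext hsum]
  exact (tendsto_const_nhds.sub hlog).sub ((tendsto_finsetSum _ fun n _ => hfin n).add htail)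

theorem integral_log_div_add {z : ℂ} (hz : z ∈ Complex.slitPlane) (N : ℕ) :
    ∫ v in (0 : ℝ)..N, Complex.log (z + v) / (z + v)
      = (Complex.log (z + N) ^ 2 - Complex.log z ^ 2) / 2 := by
  have hs : ∀ v ∈ Set.uIcc (0 : ℝ) N, z + (v : ℂ) ∈ Complex.slitPlane := by
    intro v hv
    rw [Set.uIcc_of_le (Nat.cast_nonneg N)] at hv
    exact add_ofReal_mem_slitPlane hz hv.1
  have hd : ∀ v ∈ Set.uIcc (0 : ℝ) N, HasDerivAt (fun v : ℝ => Complex.log (z + v) ^ 2 / 2)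
      (Complex.log (z + v) / (z + v)) v := by
    intro v hv
    have h1 : HasDerivAt (fun v : ℝ => z + (v : ℂ)) 1 v :=
      (Complex.ofRealCLM.hasDerivAt (x := v)).const_add z
    have h2 := ((h1.clog_real (hs v hv)).pow 2).div_const 2
    refine h2.congr_deriv ?_
    simp
    ring
  rw [intervalIntegral.integral_eq_sub_of_hasDerivAt hd]
  · simp
    ring
  · refine ContinuousOn.intervalIntegrable ?_
    have h1 : ContinuousOn (fun v : ℝ => z + (v : ℂ)) (Set.uIcc 0 N) := by fun_prop
    exact (h1.clog hs).div h1 fun v hv => Complex.slitPlane_ne_zero (hs v hv)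

theorem integral_one_div_add {z : ℂ} (hz : z ∈ Complex.slitPlane) (N : ℕ) :
    ∫ v in (0 : ℝ)..N, 1 / (z + v) = Complex.log (z + N) - Complex.log z := by
  have hs : ∀ v ∈ Set.uIcc (0 : ℝ) N, z + (v : ℂ) ∈ Complex.slitPlane := by
    intro v hv
    rw [Set.uIcc_of_le (Nat.cast_nonneg N)] at hv
    exact add_ofReal_mem_slitPlane hz hv.1
  have hd : ∀ v ∈ Set.uIcc (0 : ℝ) N, HasDerivAt (fun v : ℝ => Complex.log (z + v))
      (1 / (z + v)) v := by
    intro v hv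
    have h1 : HasDerivAt (fun v : ℝ => z + (v : ℂ)) 1 v :=
      (Complex.ofRealCLM.hasDerivAt (x := v)).const_add z
    exact h1.clog_real (hs v hv)
  rw [intervalIntegral.integral_eq_sub_of_hasDerivAt hd]
  · simp
  · refine ContinuousOn.intervalIntegrable ?_
    have h1 : ContinuousOn (fun v : ℝ => z + (v : ℂ)) (Set.uIcc 0 N) := by fun_prop
    exact continuousOn_const.div h1 fun v hv => Complex.slitPlane_ne_zero (hs v hv)

/-- `log (z + N) - log N = O(1/N)`, also after multiplication by `log N`. -/
theorem tendsto_log_add_natCast_sub_log (z : ℂ) :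
    Tendsto (fun N : ℕ => Complex.log (z + N) - (Real.log N : ℂ)) atTop (𝓝 0) ∧
    Tendsto (fun N : ℕ => Complex.log (z + N) ^ 2 - (Real.log N : ℂ) ^ 2) atTop (𝓝 0) := by
  have hb : ∀ᶠ N : ℕ in atTop,
      ‖Complex.log (z + N) - (Real.log N : ℂ)‖ ≤ 3 / 2 * ‖z‖ * (1 / (N : ℝ)) := by
    filter_upwards [tendsto_natCast_atTop_atTop.eventually (eventually_ge_atTop (2 * ‖z‖)),
      eventually_ge_atTop 1] with N hN hN1
    obtain ⟨n, rfl⟩ : ∃ n, N = n + 1 := ⟨N - 1, by omega⟩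
    push_cast at hN
    have hz : ‖z‖ ≤ ((n : ℝ) + 1) / 2 := by linarith
    rw [add_comm z, log_natCast_succ_add hz]
    push_cast
    rw [add_sub_cancel_left]
    refine (norm_log_one_add_div_le hz).trans (le_of_eq (by ring))
  have h0 : Tendsto (fun N : ℕ => 3 / 2 * ‖z‖ * (1 / (N : ℝ))) atTop (𝓝 0) := by
    simpa using tendsto_one_div_atTop_nhds_zero_nat.const_mul (3 / 2 * ‖z‖)
  have h1 : Tendsto (fun N : ℕ => Complex.log (z + N) - (Real.log N : ℂ)) atTop (𝓝 0) :=
    squeeze_zero_norm' hb h0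
  have hlog : Tendsto (fun N : ℕ => 3 / 2 * ‖z‖ * (Real.log N / (N : ℝ))) atTop (𝓝 0) := by
    have : Tendsto (fun x : ℝ => Real.log x / x) atTop (𝓝 0) := by
      simpa using Real.tendsto_pow_log_div_mul_add_atTop 1 0 1 one_ne_zero
    simpa using (this.comp tendsto_natCast_atTop_atTop).const_mul (3 / 2 * ‖z‖)
  have h2 : Tendsto (fun N : ℕ => (Complex.log (z + N) - (Real.log N : ℂ)) * (Real.log N : ℂ))
      atTop (𝓝 0) := by
    refine squeeze_zero_norm' ?_ hlog
    filter_upwards [hb, eventually_ge_atTop 1] with N hN hN1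
    have hl : 0 ≤ Real.log N := Real.log_nonneg (by exact_mod_cast hN1)
    rw [norm_mul, Complex.norm_real, Real.norm_of_nonneg hl]
    refine (mul_le_mul_of_nonneg_right hN hl).trans (le_of_eq (by ring))
  refine ⟨h1, ?_⟩
  have := (h1.mul h1).add (h2.const_mul 2)
  simp only [mul_zero, add_zero] at this
  exact this.congr fun N => by ring

theorem mul_mem_slitPlane {c w : ℂ} (hc : 0 < c.re) (hw : 0 < w.re) :
    c * w ∈ Complex.slitPlane := by
  by_cases h : (c * w).im = 0
  · left
    rw [Complex.mul_im] at h
    rw [Complex.mul_re]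
    have h1 : c.re * (c.re * w.re - c.im * w.im) = w.re * (c.re ^ 2 + c.im ^ 2) := by
      linear_combination (-c.im) * h
    have h2 : 0 < w.re * (c.re ^ 2 + c.im ^ 2) := by positivity
    rw [← h1] at h2
    exact (mul_pos_iff_of_pos_left hc).mp h2
  · exact Or.inr h

/-- The Euler–Maclaurin limit for `log (z + v) / (z + v)` at `z = cw`. -/
theorem tendsto_sum_log_div {w c : ℂ} (hw : 0 < w.re) (hc : 0 < c.re) :
    Tendsto (fun N : ℕ => -∑ n ∈ Finset.range N,
        Complex.log (((n + 1 : ℕ) : ℂ) + c * w) / (((n + 1 : ℕ) : ℂ) + c * w)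
        + (Real.log N : ℂ) ^ 2 / 2) atTop
      (𝓝 ((∫ u : ℝ in Set.Ioi 0, Complex.exp (-(c * u))
          * (logRay w u + (Real.eulerMascheroniConstant : ℂ)) * binetKernel w u) / w
        + Complex.log (c * w) ^ 2 / 2 + Complex.log (c * w) / (c * w) / 2)) := by
  have hw0 : w ≠ 0 := by rintro rfl; simp at hw
  have hs := mul_mem_slitPlane hc hw
  have hlam : ∀ v : ℝ, 0 ≤ v → ∫ u : ℝ in Set.Ioi 0, Complex.exp (-((c + (v : ℂ) / w) * u))
      * (logRay w u + (Real.eulerMascheroniConstant : ℂ))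
      = -w * (Complex.log (c * w + v) / (c * w + v)) := by
    intro v hv
    rw [integral_exp_neg_mul_logRay (re_add_ofReal_div_pos hw hc hv) hw]
    have h1 : (c + (v : ℂ) / w) * w = c * w + v := by field_simp
    have h2 : c + (v : ℂ) / w = (c * w + v) / w := by field_simp
    have h3 : c * w + v ≠ 0 := Complex.slitPlane_ne_zero (add_ofReal_mem_slitPlane hs hv)
    rw [h1, h2]
    field_simp
  have h := ((isLogWeight_logRay_add w _).tendsto_sum_sub_integral hw hc hlam).div_const w
  have h2 := (tendsto_log_add_natCast_sub_log (c * w)).2.div_const 2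
  have h3 := ((h.sub h2).add_const (Complex.log (c * w) ^ 2 / 2)).add_const
    (Complex.log (c * w) / (c * w) / 2)
  rw [zero_div, sub_zero] at h3
  refine h3.congr fun N => ?_
  rw [intervalIntegral.integral_const_mul, integral_log_div_add hs, ← Finset.mul_sum]
  have e : ∑ n ∈ Finset.range N, Complex.log (c * w + (((n + 1 : ℕ) : ℝ) : ℂ))
        / (c * w + (((n + 1 : ℕ) : ℝ) : ℂ))
      = ∑ n ∈ Finset.range N, Complex.log (((n + 1 : ℕ) : ℂ) + c * w)
        / (((n + 1 : ℕ) : ℂ) + c * w) :=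
    Finset.sum_congr rfl fun n _ => by rw [Complex.ofReal_natCast, add_comm]
  rw [e]
  have hz0 := Complex.slitPlane_ne_zero hs
  simp only [Complex.ofReal_zero, add_zero]
  generalize Complex.log (c * w) / (c * w) = q
  field_simp
  ring

/-- The limit defining the first Stieltjes constant exists. -/
theorem tendsto_stieltjesGammaOne :
    Tendsto (fun n : ℕ => ∑ j ∈ Finset.Icc 1 n, Real.log (j : ℝ) / (j : ℝ)
      - Real.log (n : ℝ) ^ 2 / 2) atTop (𝓝 stieltjesGammaOne) := by
  have h := tendsto_sum_log_div (w := 1) (c := 1) (by simp) (by simp)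
  set I := (∫ u : ℝ in Set.Ioi 0, Complex.exp (-((1 : ℂ) * u))
          * (logRay 1 u + (Real.eulerMascheroniConstant : ℂ)) * binetKernel 1 u) / 1
        + Complex.log (1 * 1) ^ 2 / 2 + Complex.log (1 * 1) / (1 * 1) / 2
  have h2 := ((tendsto_log_add_natCast_sub_log 1).2.div_const 2)
  rw [zero_div] at h2
  have h3 := (Complex.continuous_re.tendsto _).comp (h.add h2).neg
  have hex : Tendsto (fun n : ℕ => ∑ j ∈ Finset.Icc 1 n, Real.log (j : ℝ) / (j : ℝ)
      - Real.log (n : ℝ) ^ 2 / 2) atTop (𝓝 (-(I + 0)).re) := by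
    refine (tendsto_add_atTop_iff_nat 1).mp (h3.congr fun N => ?_)
    have e1 : ∑ n ∈ Finset.range N, Complex.log (((n + 1 : ℕ) : ℂ) + 1 * 1)
        / (((n + 1 : ℕ) : ℂ) + 1 * 1)
        = ((∑ j ∈ Finset.Icc 1 (N + 1), Real.log (j : ℝ) / (j : ℝ) : ℝ) : ℂ) := by
      induction N with
      | zero => simp
      | succ N ih =>
        rw [Finset.sum_range_succ, ih, Finset.sum_Icc_succ_top (b := N + 1) (by omega),
          Complex.ofReal_add, Complex.ofReal_div (Real.log _), Complex.natCast_log,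
          Complex.ofReal_natCast]
        push_cast
        ring_nf
    have e2 : Complex.log (1 + (N : ℂ)) = (Real.log ((N + 1 : ℕ) : ℝ) : ℂ) := by
      rw [Complex.natCast_log]; push_cast; rw [add_comm]
    simp only [Function.comp]
    rw [e1, e2]
    have : ∀ a b c : ℝ, (-(-(a : ℂ) + (c : ℂ) ^ 2 / 2 + ((b : ℂ) ^ 2 - (c : ℂ) ^ 2) / 2)).re
        = a - b ^ 2 / 2 := by
      intro a b c
      rw [← Complex.ofReal_re (a - b ^ 2 / 2)]
      congr 1
      push_cast
      ring
    exact this _ _ _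
  rw [stieltjesGammaOne, hex.limUnder_eq]
  exact hex

theorem tendsto_sum_log_div_psiOne (z : ℂ) :
    Tendsto (fun N : ℕ => -∑ n ∈ Finset.range N,
        Complex.log (((n + 1 : ℕ) : ℂ) + z) / (((n + 1 : ℕ) : ℂ) + z)
        + (Real.log N : ℂ) ^ 2 / 2) atTop (𝓝 (psiOne z + Complex.log z / z)) := by
  have h1 := (summable_psiOneTerm z).hasSum.tendsto_sum_nat.neg
  have h2 := ((Complex.continuous_ofReal.tendsto _).comp tendsto_stieltjesGammaOne).neg
  have h3 := h1.add h2
  have e : psiOne z + Complex.log z / z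
      = -∑' n : ℕ, psiOneTerm z n + -(stieltjesGammaOne : ℂ) := by
    rw [psiOne]; unfold psiOneTerm; ring
  rw [e]
  refine h3.congr fun N => ?_
  have e1 : ∑ n ∈ Finset.range N, psiOneTerm z n = ∑ n ∈ Finset.range N,
      Complex.log (((n + 1 : ℕ) : ℂ) + z) / (((n + 1 : ℕ) : ℂ) + z)
      - ((∑ j ∈ Finset.Icc 1 N, Real.log (j : ℝ) / (j : ℝ) : ℝ) : ℂ) := by
    induction N with
    | zero => simp
    | succ N ih =>
      rw [Finset.sum_range_succ, Finset.sum_range_succ, ih, Finset.sum_Icc_succ_top (by omega),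
        Complex.ofReal_add, Complex.ofReal_div, Complex.natCast_log, Complex.ofReal_natCast,
        psiOneTerm]
      ring
  simp only [Function.comp]
  rw [e1]
  push_cast
  ring

/-- Binet-type formula along the ray through `1 / w`, for the logarithmic weight. -/
theorem integral_logRay_mul_binetKernel {w c : ℂ} (hw : 0 < w.re) (hc : 0 < c.re) :
    ∫ u : ℝ in Set.Ioi 0, Complex.exp (-(c * u)) * logRay w u * binetKernel w u
      = w * (psiOne (c * w) + Complex.log (c * w) / (2 * (c * w)) - Complex.log (c * w) ^ 2 / 2
        + (Real.eulerMascheroniConstant : ℂ) * (Complex.digamma (c * w) - Complex.log (c * w)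
          + 1 / (2 * (c * w)))) := by
  have hw0 : w ≠ 0 := by rintro rfl; simp at hw
  have hs := mul_mem_slitPlane hc hw
  have hz0 := Complex.slitPlane_ne_zero hs
  obtain ⟨B, hB, hK⟩ := exists_norm_binetKernel_le hw
  have hKm : AEStronglyMeasurable (binetKernel w) (volume.restrict (Set.Ioi 0)) :=
    (continuousOn_binetKernel hw).aestronglyMeasurable measurableSet_Ioi
  have hK' : ∀ u : ℝ, 0 < u → ‖binetKernel w u‖ ≤ B * (1 + u ^ (1 / 2 : ℝ)) := by
    intro u hu
    have := hK u hu
    nlinarith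
  have hA := tendsto_nhds_unique (tendsto_sum_log_div hw hc) (tendsto_sum_log_div_psiOne (c * w))
  have hB' : (∫ u : ℝ in Set.Ioi 0, Complex.exp (-(c * u)) * 1 * binetKernel w u) / w
      = -Complex.digamma (c * w) + Complex.log (c * w) - 1 / (c * w) / 2 := by
    have hlam : ∀ v : ℝ, 0 ≤ v → ∫ u : ℝ in Set.Ioi 0, Complex.exp (-((c + (v : ℂ) / w) * u)) * 1
        = w * (1 / (c * w + v)) := by
      intro v hv
      simp_rw [mul_one]
      rw [integral_exp_neg_mul_Ioi (re_add_ofReal_div_pos hw hc hv)]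
      have h2 : c + (v : ℂ) / w = (c * w + v) / w := by field_simp
      rw [h2]
      field_simp
    have h := ((isLogWeight_const 1).tendsto_sum_sub_integral hw hc hlam).div_const w
    have h2 := (tendsto_log_add_natCast_sub_log (c * w)).1
    have h3 := tendsto_log_sub_sum_digamma (ne_neg_natCast_of_mem_slitPlane hs)
    have h4 := (h3.neg.sub h2).add_const (Complex.log (c * w) - 1 / (c * w) / 2)
    rw [sub_zero] at h4
    have := tendsto_nhds_unique h (h4.congr fun N => ?_)
    · rw [this]; ring
    · rw [intervalIntegral.integral_const_mul, integral_one_div_add hs, ← Finset.mul_sum,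
        Finset.sum_range_succ']
      have e : ∑ n ∈ Finset.range N, 1 / (c * w + (((n + 1 : ℕ) : ℝ) : ℂ))
          = ∑ n ∈ Finset.range N, 1 / (c * w + ((n + 1 : ℕ) : ℂ)) :=
        Finset.sum_congr rfl fun n _ => by rw [Complex.ofReal_natCast]
      rw [e]
      simp only [Complex.ofReal_zero, add_zero, Nat.cast_zero]
      generalize 1 / (c * w) = q
      field_simp
      ring
  have hsplit : ∫ u : ℝ in Set.Ioi 0, Complex.exp (-(c * u)) * logRay w u * binetKernel w u
      = (∫ u : ℝ in Set.Ioi 0, Complex.exp (-(c * u))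
          * (logRay w u + (Real.eulerMascheroniConstant : ℂ)) * binetKernel w u)
        - (Real.eulerMascheroniConstant : ℂ)
          * ∫ u : ℝ in Set.Ioi 0, Complex.exp (-(c * u)) * 1 * binetKernel w u := by
    rw [← integral_const_mul, ← integral_sub]
    · exact setIntegral_congr_fun measurableSet_Ioi fun u _ => by ring
    · exact (isLogWeight_logRay_add w _).integrableOn_exp_mul hc hKm hK'
    · exact ((isLogWeight_const 1).integrableOn_exp_mul hc hKm hK').const_mul _
  rw [div_eq_iff hw0] at hB'
  rw [hsplit, hB']
  have hA' : (∫ u : ℝ in Set.Ioi 0, Complex.exp (-(c * u))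
          * (logRay w u + (Real.eulerMascheroniConstant : ℂ)) * binetKernel w u)
      = (psiOne (c * w) + Complex.log (c * w) / (c * w) - Complex.log (c * w) ^ 2 / 2
        - Complex.log (c * w) / (c * w) / 2) * w := by
    rw [← div_eq_iff hw0]
    linear_combination hA
  rw [hA']
  field_simp
  ring

/-! ### Two integrations by parts: pointwise bounds -/

/-- The non-oscillating factor `u log (u/w) / (u² + (2π(m+1)w)²)` of the `m`-th integrand. -/
noncomputable def rayIntegrand (w : ℂ) (m : ℕ) (u : ℝ) : ℂ :=
  u * logRay w u / ((u : ℂ) ^ 2 + poleParam w m ^ 2)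

/-- The first derivative of `rayIntegrand`. -/
noncomputable def rayIntegrandDeriv (w : ℂ) (m : ℕ) (u : ℝ) : ℂ :=
  1 / ((u : ℂ) ^ 2 + poleParam w m ^ 2)
    + logRay w u * (poleParam w m ^ 2 - (u : ℂ) ^ 2) / ((u : ℂ) ^ 2 + poleParam w m ^ 2) ^ 2

/-- The second derivative of `rayIntegrand`. -/
noncomputable def rayIntegrandDerivTwo (w : ℂ) (m : ℕ) (u : ℝ) : ℂ :=
  -(2 * u) / ((u : ℂ) ^ 2 + poleParam w m ^ 2) ^ 2
    + (poleParam w m ^ 2 - (u : ℂ) ^ 2) / (u * ((u : ℂ) ^ 2 + poleParam w m ^ 2) ^ 2)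
    + logRay w u * (2 * u * ((u : ℂ) ^ 2 - 3 * poleParam w m ^ 2))
      / ((u : ℂ) ^ 2 + poleParam w m ^ 2) ^ 3

theorem hasDerivAt_logRay (w : ℂ) {u : ℝ} (hu : 0 < u) :
    HasDerivAt (logRay w) (1 / (u : ℂ)) u := by
  have := ((Real.hasDerivAt_log hu.ne').ofReal_comp).sub_const (Complex.log w)
  refine this.congr_deriv ?_
  push_cast
  rw [one_div]

theorem hasDerivAt_sq_add (a : ℂ) (u : ℝ) :
    HasDerivAt (fun u : ℝ => (u : ℂ) ^ 2 + a) (2 * u) u := by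
  have := ((Complex.ofRealCLM.hasDerivAt (x := u)).pow 2).add_const a
  refine this.congr_deriv ?_
  simp

theorem hasDerivAt_rayIntegrand {w : ℂ} (hw : 0 < w.re) (m : ℕ) {u : ℝ} (hu : 0 < u) :
    HasDerivAt (rayIntegrand w m) (rayIntegrandDeriv w m u) u := by
  have hD := sq_add_poleParam_sq_ne_zero hw m hu.le
  have hu0 : (u : ℂ) ≠ 0 := by exact_mod_cast hu.ne'
  have h := ((Complex.ofRealCLM.hasDerivAt (x := u)).mul (hasDerivAt_logRay w hu)).div
    (hasDerivAt_sq_add (poleParam w m ^ 2) u) hD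
  refine h.congr_deriv ?_
  simp only [rayIntegrandDeriv, Complex.ofRealCLM_apply, Complex.ofReal_one, Pi.mul_apply]
  field_simp
  ring

theorem hasDerivAt_rayIntegrandDeriv {w : ℂ} (hw : 0 < w.re) (m : ℕ) {u : ℝ} (hu : 0 < u) :
    HasDerivAt (rayIntegrandDeriv w m) (rayIntegrandDerivTwo w m u) u := by
  have hD := sq_add_poleParam_sq_ne_zero hw m hu.le
  have hu0 : (u : ℂ) ≠ 0 := by exact_mod_cast hu.ne'
  have hd := hasDerivAt_sq_add (poleParam w m ^ 2) u
  have h0 : HasDerivAt (fun u : ℝ => poleParam w m ^ 2 - (u : ℂ) ^ 2) (-(2 * u)) u := by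
    have := ((Complex.ofRealCLM.hasDerivAt (x := u)).pow 2).const_sub (poleParam w m ^ 2)
    refine this.congr_deriv ?_
    simp
  have h := ((hasDerivAt_const u (1 : ℂ)).div hd hD).add
    (((hasDerivAt_logRay w hu).mul h0).div (hd.pow 2) (pow_ne_zero 2 hD))
  refine h.congr_deriv ?_
  simp only [rayIntegrandDerivTwo, Pi.mul_apply, Pi.pow_apply]
  field_simp
  ring

/-- The antiderivative of `e^{-cu} f(u) + (1 - e^{-cu}) f''(u) / c²` that integration by parts
(twice) produces. -/
noncomputable def partsPrimitive (w c : ℂ) (m : ℕ) (u : ℝ) : ℂ :=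
  (1 - Complex.exp (-(c * u))) * rayIntegrandDeriv w m u / c ^ 2
    - Complex.exp (-(c * u)) * rayIntegrand w m u / c

theorem hasDerivAt_partsPrimitive {w c : ℂ} (hw : 0 < w.re) (hc : c ≠ 0) (m : ℕ) {u : ℝ}
    (hu : 0 < u) :
    HasDerivAt (partsPrimitive w c m) (Complex.exp (-(c * u)) * rayIntegrand w m u
      + (1 - Complex.exp (-(c * u))) * rayIntegrandDerivTwo w m u / c ^ 2) u := by
  have h1 : HasDerivAt (fun u : ℝ => -(c * (u : ℂ))) (-c) u := by
    simpa using ((Complex.ofRealCLM.hasDerivAt (x := u)).const_mul c).fun_neg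
  have he := h1.cexp
  have h := (((he.const_sub 1).mul (hasDerivAt_rayIntegrandDeriv hw m hu)).div_const (c ^ 2)).sub
    ((he.mul (hasDerivAt_rayIntegrand hw m hu)).div_const c)
  refine h.congr_deriv ?_
  field_simp
  ring

theorem norm_one_sub_exp_neg_le {c : ℂ} (hc : 0 ≤ c.re) {u : ℝ} (hu : 0 ≤ u) :
    ‖1 - Complex.exp (-(c * u))‖ ≤ 2 * (1 + ‖c‖) * min 1 u := by
  have h2 : ‖1 - Complex.exp (-(c * u))‖ ≤ 2 := by
    refine (norm_sub_le _ _).trans ?_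
    have : ‖Complex.exp (-(c * u))‖ ≤ 1 := by
      rw [norm_exp_neg_mul_ofReal, Real.exp_le_one_iff]
      nlinarith [mul_nonneg hc hu]
    rw [norm_one]; linarith
  have h1 : ‖1 - Complex.exp (-(c * u))‖ ≤ 2 * (‖c‖ * u) := by
    have hn : ‖-(c * (u : ℂ))‖ = ‖c‖ * u := by
      rw [norm_neg, norm_mul, Complex.norm_real, Real.norm_of_nonneg hu]
    rcases le_total (‖c‖ * u) 1 with h | h
    · rw [norm_sub_rev, ← hn]
      exact Complex.norm_exp_sub_one_le (by rwa [hn])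
    · linarith
  rcases le_total 1 u with h | h
  · rw [min_eq_left h]
    nlinarith [norm_nonneg c]
  · rw [min_eq_right h]
    nlinarith [norm_nonneg c]

/-- The integrable majorant for the twice integrated by parts integrals. -/
noncomputable def partsMajorant (u : ℝ) : ℝ :=
  if u ≤ 1 then u ^ (-(1 / 2) : ℝ) else u ^ (-(5 / 4) : ℝ)

theorem partsMajorant_nonneg {u : ℝ} (hu : 0 < u) : 0 ≤ partsMajorant u := by
  unfold partsMajorant
  split_ifs <;> positivity

theorem integrableOn_partsMajorant : IntegrableOn partsMajorant (Set.Ioi 0) := by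
  rw [← Set.Ioc_union_Ioi_eq_Ioi zero_le_one]
  refine IntegrableOn.union ?_ ?_
  · have h : IntegrableOn (fun u : ℝ => u ^ (-(1 / 2) : ℝ)) (Set.Ioc 0 1) :=
      (intervalIntegrable_iff_integrableOn_Ioc_of_le zero_le_one).mp
        (intervalIntegral.intervalIntegrable_rpow' (by norm_num))
    exact h.congr_fun (fun u hu => by simp [partsMajorant, hu.2]) measurableSet_Ioc
  · have h : IntegrableOn (fun u : ℝ => u ^ (-(5 / 4) : ℝ)) (Set.Ioi 1) :=
      integrableOn_Ioi_rpow_of_lt (by norm_num) one_pos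
    exact h.congr_fun (fun u hu => by
      have : ¬ u ≤ 1 := not_le.mpr hu
      simp [partsMajorant, this]) measurableSet_Ioi

/-- The elementary inequality behind the choice of the exponents in `partsMajorant`. -/
theorem min_div_add_le_partsMajorant {u X : ℝ} (hu : 0 < u) (hXn : 1 ≤ X) (hXu : u ^ 2 ≤ X) :
    min 1 u / u + min 1 u * ((u ^ (1 / 4 : ℝ) + u ^ (-(1 / 4) : ℝ)) * u / X)
      ≤ 3 * partsMajorant u * u ^ (1 / 2 : ℝ) := by
  have hX0 : 0 < X := by linarith
  set W : ℝ := u ^ (1 / 4 : ℝ) + u ^ (-(1 / 4) : ℝ) with hW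
  rcases le_or_gt u 1 with h | h
  · have e : partsMajorant u * u ^ (1 / 2 : ℝ) = 1 := by
      rw [partsMajorant, if_pos h, ← Real.rpow_add hu]; norm_num
    rw [min_eq_right h, mul_assoc, e, div_self hu.ne']
    have h1 : u ^ (1 / 4 : ℝ) ≤ 1 := Real.rpow_le_one hu.le h (by norm_num)
    have h2 : u ^ (-(1 / 4) : ℝ) * u ≤ 1 := by
      nth_rewrite 2 [← Real.rpow_one u]
      rw [← Real.rpow_add hu]
      exact Real.rpow_le_one hu.le h (by norm_num)
    have h5 : u ^ (1 / 4 : ℝ) * u ≤ 1 := mul_le_one₀ h1 hu.le h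
    have h3 : W * u ≤ 2 := by rw [hW, add_mul]; linarith
    have h4 : W * u / X ≤ 2 := by rw [div_le_iff₀ hX0]; linarith
    have h6 : u * (W * u / X) ≤ 1 * 2 := mul_le_mul h h4 (by positivity) zero_le_one
    linarith
  · have e : partsMajorant u * u ^ (1 / 2 : ℝ) = u ^ (1 / 4 : ℝ) / u := by
      rw [partsMajorant, if_neg (not_le.mpr h), ← Real.rpow_add hu, ← Real.rpow_sub_one hu.ne']
      norm_num
    rw [min_eq_left h.le, mul_assoc, e, one_mul]
    have h1 : 1 ≤ u ^ (1 / 4 : ℝ) := Real.one_le_rpow h.le (by norm_num)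
    have h2 : u ^ (-(1 / 4) : ℝ) ≤ 1 :=
      Real.rpow_le_one_of_one_le_of_nonpos h.le (by norm_num)
    have h3 : W * u / X ≤ 2 * u ^ (1 / 4 : ℝ) / u := by
      rw [div_le_div_iff₀ hX0 hu]
      have : W ≤ 2 * u ^ (1 / 4 : ℝ) := by rw [hW]; linarith
      calc W * u * u = W * u ^ 2 := by ring
        _ ≤ 2 * u ^ (1 / 4 : ℝ) * X := by gcongr
    have h4 : 1 / u ≤ u ^ (1 / 4 : ℝ) / u := by gcongr
    calc 1 / u + W * u / X ≤ u ^ (1 / 4 : ℝ) / u + 2 * u ^ (1 / 4 : ℝ) / u := by linarith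
      _ = _ := by ring

theorem norm_poleParam_sq (w : ℂ) (m : ℕ) :
    ‖poleParam w m ^ 2‖ = (2 * Real.pi * ‖w‖) ^ 2 * ((m : ℝ) + 1) ^ 2 := by
  rw [norm_pow, poleParam, norm_mul, norm_mul, norm_mul, Complex.norm_natCast, Complex.norm_real,
    Real.norm_of_nonneg Real.pi_nonneg]
  push_cast
  simp
  ring

/-- Bounds of the integrand and its first derivative. -/
theorem exists_norm_rayIntegrand_le {w : ℂ} (hw : 0 < w.re) :
    ∃ C : ℝ, 0 < C ∧ ∀ (m : ℕ) (u : ℝ), 0 < u →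
      ‖rayIntegrand w m u‖
        ≤ C * (u * (u ^ (1 / 4 : ℝ) + u ^ (-(1 / 4) : ℝ)) / (u ^ 2 + 1)) ∧
      ‖rayIntegrandDeriv w m u‖
        ≤ C * ((u ^ (1 / 4 : ℝ) + u ^ (-(1 / 4) : ℝ)) / (u ^ 2 + 1)) := by
  obtain ⟨C₀, hC₀, hD⟩ := exists_sq_add_sq_le_norm hw
  obtain ⟨C₁, hC₁, hL⟩ : ∃ C : ℝ, 0 < C ∧ ∀ u : ℝ, 0 < u →
      ‖logRay w u‖ ≤ C * (u ^ (1 / 4 : ℝ) + u ^ (-(1 / 4) : ℝ)) := by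
    simpa using (isLogWeight_logRay_add w 0).2
  set A : ℝ := (2 * Real.pi * ‖w‖) ^ 2 with hA
  refine ⟨C₁ * C₀ + (C₀ + C₁ * (A + 1) * C₀ ^ 2), by positivity, fun m u hu => ?_⟩
  set n : ℝ := (m : ℝ) + 1 with hn
  have hn1 : 1 ≤ n := by have := Nat.cast_nonneg (α := ℝ) m; linarith
  set W : ℝ := u ^ (1 / 4 : ℝ) + u ^ (-(1 / 4) : ℝ) with hW
  have hW1 : 1 ≤ W := one_le_rpow_add_rpow_neg hu
  have hX : u ^ 2 + 1 ≤ u ^ 2 + n ^ 2 := by nlinarith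
  have hXD := hD m u hu.le
  have hDpos := norm_pos_iff.mpr (sq_add_poleParam_sq_ne_zero hw m hu.le)
  set D : ℝ := ‖(u : ℂ) ^ 2 + poleParam w m ^ 2‖ with hDdef
  have hinv : 1 / D ≤ C₀ / (u ^ 2 + 1) := by
    rw [div_le_div_iff₀ hDpos (by positivity)]; linarith
  have hinvX : 1 / D ≤ C₀ / (u ^ 2 + n ^ 2) := by
    rw [div_le_div_iff₀ hDpos (by positivity)]; linarith
  have hnum : ‖poleParam w m ^ 2 - (u : ℂ) ^ 2‖ ≤ (A + 1) * (u ^ 2 + n ^ 2) := by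
    refine (norm_sub_le _ _).trans ?_
    rw [norm_poleParam_sq, norm_pow, Complex.norm_real, Real.norm_of_nonneg hu.le, ← hA, ← hn]
    nlinarith [mul_nonneg (show 0 ≤ A by positivity) (sq_nonneg u), sq_nonneg n]
  have hu2 : ‖(u : ℂ)‖ = u := by rw [Complex.norm_real, Real.norm_of_nonneg hu.le]
  constructor
  · rw [rayIntegrand, norm_div, norm_mul, hu2, ← hDdef]
    calc u * ‖logRay w u‖ / D = u * ‖logRay w u‖ * (1 / D) := by ring
      _ ≤ u * (C₁ * W) * (C₀ / (u ^ 2 + 1)) := by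
          have := hL u hu
          gcongr
      _ = C₁ * C₀ * (u * W / (u ^ 2 + 1)) := by ring
      _ ≤ _ := by
          refine mul_le_mul_of_nonneg_right ?_ (by positivity)
          have : 0 ≤ C₀ + C₁ * (A + 1) * C₀ ^ 2 := by positivity
          linarith
  · calc ‖rayIntegrandDeriv w m u‖
        ≤ 1 / D + ‖logRay w u‖ * ‖poleParam w m ^ 2 - (u : ℂ) ^ 2‖ / D ^ 2 := by
          rw [rayIntegrandDeriv]
          refine (norm_add_le _ _).trans (le_of_eq ?_)
          rw [norm_div, norm_div, norm_mul, norm_pow, norm_one]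
      _ = 1 / D + ‖logRay w u‖ * ‖poleParam w m ^ 2 - (u : ℂ) ^ 2‖ * (1 / D) * (1 / D) := by
          ring
      _ ≤ C₀ / (u ^ 2 + 1) * W + C₁ * W * ((A + 1) * (u ^ 2 + n ^ 2)) * (C₀ / (u ^ 2 + n ^ 2))
            * (C₀ / (u ^ 2 + 1)) := by
          have := hL u hu
          have h1 : 1 / D ≤ C₀ / (u ^ 2 + 1) * W :=
            hinv.trans (le_mul_of_one_le_right (by positivity) hW1)
          gcongr
      _ = (C₀ + C₁ * (A + 1) * C₀ ^ 2) * (W / (u ^ 2 + 1)) := by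
          have : u ^ 2 + n ^ 2 ≠ 0 := by positivity
          field_simp
      _ ≤ _ := by
          refine mul_le_mul_of_nonneg_right ?_ (by positivity)
          have : 0 ≤ C₁ * C₀ := by positivity
          linarith

/-- The bound of the second derivative that makes the integrals summable over `m`: interpolating
`u² + n² ≥ n^{3/2} u^{1/2}` trades integrability in `u` for decay in `n = m + 1`. -/
theorem exists_min_mul_norm_rayIntegrandDerivTwo_le {w : ℂ} (hw : 0 < w.re) :
    ∃ C : ℝ, 0 < C ∧ ∀ (m : ℕ) (u : ℝ), 0 < u →
      min 1 u * ‖rayIntegrandDerivTwo w m u‖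
        ≤ C * ((m : ℝ) + 1) ^ (-(3 / 2) : ℝ) * partsMajorant u := by
  obtain ⟨C₀, hC₀, hD⟩ := exists_sq_add_sq_le_norm hw
  obtain ⟨C₁, hC₁, hL⟩ : ∃ C : ℝ, 0 < C ∧ ∀ u : ℝ, 0 < u →
      ‖logRay w u‖ ≤ C * (u ^ (1 / 4 : ℝ) + u ^ (-(1 / 4) : ℝ)) := by
    simpa using (isLogWeight_logRay_add w 0).2
  set A : ℝ := (2 * Real.pi * ‖w‖) ^ 2 with hA
  have hA0 : 0 ≤ A := by positivity
  set K : ℝ := 2 * C₀ ^ 2 + (A + 1) * C₀ ^ 2 + 2 * C₁ * (3 * A + 1) * C₀ ^ 3 with hK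
  have hK0 : 0 < K := by positivity
  refine ⟨K * 3, by positivity, fun m u hu => ?_⟩
  set n : ℝ := (m : ℝ) + 1 with hn
  have hn1 : 1 ≤ n := by have := Nat.cast_nonneg (α := ℝ) m; linarith
  have hn0 : 0 < n := by linarith
  set W : ℝ := u ^ (1 / 4 : ℝ) + u ^ (-(1 / 4) : ℝ) with hW
  have hW1 : 1 ≤ W := one_le_rpow_add_rpow_neg hu
  have hXD := hD m u hu.le
  have hDpos := norm_pos_iff.mpr (sq_add_poleParam_sq_ne_zero hw m hu.le)
  set D : ℝ := ‖(u : ℂ) ^ 2 + poleParam w m ^ 2‖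
  set X : ℝ := u ^ 2 + n ^ 2 with hX
  have hX0 : 0 < X := by positivity
  have hXu : u ^ 2 ≤ X := by nlinarith
  have hXn : 1 ≤ X := by nlinarith [sq_nonneg u]
  have hinv : 1 / D ≤ C₀ / X := by
    rw [div_le_div_iff₀ hDpos hX0]; linarith
  have hu2 : ‖(u : ℂ)‖ = u := by rw [Complex.norm_real, Real.norm_of_nonneg hu.le]
  have ha := norm_poleParam_sq w m
  rw [← hA, ← hn] at ha
  have hn2 : A * n ^ 2 ≤ A * X := by nlinarith [mul_nonneg hA0 (sq_nonneg u)]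
  have hnum1 : ‖poleParam w m ^ 2 - (u : ℂ) ^ 2‖ ≤ (A + 1) * X := by
    refine (norm_sub_le _ _).trans ?_
    rw [ha, norm_pow, hu2]
    linarith
  have hnum2 : ‖(u : ℂ) ^ 2 - 3 * poleParam w m ^ 2‖ ≤ (3 * A + 1) * X := by
    refine (norm_sub_le _ _).trans ?_
    rw [norm_mul, ha, norm_pow, hu2]
    simp only [Complex.norm_ofNat]
    linarith
  -- All three terms are compared with `1 / (uX)` and `W u / X²`, where `X = u² + n²`.
  have hmain : ‖rayIntegrandDerivTwo w m u‖ ≤ K * (1 / (u * X) + W * u / (X * X)) := by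
    calc ‖rayIntegrandDerivTwo w m u‖
        ≤ 2 * u / D ^ 2 + ‖poleParam w m ^ 2 - (u : ℂ) ^ 2‖ / (u * D ^ 2)
          + ‖logRay w u‖ * (2 * u * ‖(u : ℂ) ^ 2 - 3 * poleParam w m ^ 2‖) / D ^ 3 := by
          rw [rayIntegrandDerivTwo]
          refine (norm_add₃_le).trans (le_of_eq ?_)
          simp only [norm_div, norm_mul, norm_pow, norm_neg, hu2, Complex.norm_ofNat]
          rfl
      _ = 2 * u * ((1 / D) * (1 / D))
          + ‖poleParam w m ^ 2 - (u : ℂ) ^ 2‖ * (1 / u) * ((1 / D) * (1 / D))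
          + ‖logRay w u‖ * (2 * u * ‖(u : ℂ) ^ 2 - 3 * poleParam w m ^ 2‖)
            * ((1 / D) * (1 / D) * (1 / D)) := by
          field_simp
      _ ≤ 2 * u * ((C₀ / X) * (C₀ / X))
          + (A + 1) * X * (1 / u) * ((C₀ / X) * (C₀ / X))
          + C₁ * W * (2 * u * ((3 * A + 1) * X)) * ((C₀ / X) * (C₀ / X) * (C₀ / X)) := by
          have := hL u hu
          have h1D : 0 ≤ 1 / D := by positivity
          gcongr
      _ = 2 * C₀ ^ 2 * (u ^ 2 / X) * (1 / (u * X)) + (A + 1) * C₀ ^ 2 * (1 / (u * X))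
          + 2 * C₁ * (3 * A + 1) * C₀ ^ 3 * (W * u / (X * X)) := by
          field_simp
      _ ≤ 2 * C₀ ^ 2 * 1 * (1 / (u * X)) + (A + 1) * C₀ ^ 2 * (1 / (u * X))
          + 2 * C₁ * (3 * A + 1) * C₀ ^ 3 * (W * u / (X * X)) := by
          have : u ^ 2 / X ≤ 1 := (div_le_one hX0).mpr hXu
          gcongr
      _ ≤ _ := by
          have p1 : 0 ≤ 1 / (u * X) := by positivity
          have p2 : 0 ≤ W * u / (X * X) := by positivity
          have q1 : 0 ≤ 2 * C₀ ^ 2 + (A + 1) * C₀ ^ 2 := by positivity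
          have q2 : 0 ≤ 2 * C₁ * (3 * A + 1) * C₀ ^ 3 := by positivity
          have r1 := mul_nonneg q1 p2
          have r2 := mul_nonneg q2 p1
          rw [hK]
          generalize 1 / (u * X) = P at *
          generalize W * u / (X * X) = Q at *
          linarith
  set ν : ℝ := n ^ (-(3 / 2) : ℝ) with hν
  have hν0 : 0 < ν := by positivity
  have hinvX : 1 / X ≤ ν * u ^ (-(1 / 2) : ℝ) := by
    have h := rpow_mul_rpow_le_sq_add_sq hu.le hn0.le
    rw [hν, Real.rpow_neg hn0.le, Real.rpow_neg hu.le, ← mul_inv, one_div]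
    exact inv_anti₀ (by positivity) h
  have hmin0 : 0 ≤ min 1 u := le_min zero_le_one hu.le
  have hfactor := min_div_add_le_partsMajorant hu hXn hXu
  rw [← hW] at hfactor
  calc min 1 u * ‖rayIntegrandDerivTwo w m u‖
      ≤ min 1 u * (K * (1 / (u * X) + W * u / (X * X))) := by gcongr
    _ = K * ((min 1 u / u + min 1 u * (W * u / X)) * (1 / X)) := by field_simp
    _ ≤ K * (3 * partsMajorant u * u ^ (1 / 2 : ℝ) * (ν * u ^ (-(1 / 2) : ℝ))) := by
        have := partsMajorant_nonneg hu
        gcongr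
    _ = K * 3 * ν * partsMajorant u := by
        have : u ^ (1 / 2 : ℝ) * u ^ (-(1 / 2) : ℝ) = 1 := by
          rw [← Real.rpow_add hu]; norm_num
        linear_combination (K * 3 * ν * partsMajorant u) * this

/-! ### Regularised integrals, their sum, and passage to the imaginary axis -/

theorem continuousOn_rayIntegrand {w : ℂ} (hw : 0 < w.re) (m : ℕ) :
    ContinuousOn (rayIntegrand w m) (Set.Ioi 0) :=
  fun _ hu => (hasDerivAt_rayIntegrand hw m hu).continuousAt.continuousWithinAt

theorem continuousOn_rayIntegrandDerivTwo {w : ℂ} (hw : 0 < w.re) (m : ℕ) :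
    ContinuousOn (rayIntegrandDerivTwo w m) (Set.Ioi 0) := by
  have hL : ContinuousOn (logRay w) (Set.Ioi 0) :=
    fun _ hu => (hasDerivAt_logRay w hu).continuousAt.continuousWithinAt
  have hD : ∀ u ∈ Set.Ioi (0 : ℝ), (u : ℂ) ^ 2 + poleParam w m ^ 2 ≠ 0 := fun u hu =>
    sq_add_poleParam_sq_ne_zero hw m (le_of_lt hu)
  have h0 : ∀ u ∈ Set.Ioi (0 : ℝ), (u : ℂ) ≠ 0 := fun u (hu : 0 < u) => by exact_mod_cast hu.ne'
  unfold rayIntegrandDerivTwo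
  refine ContinuousOn.add (ContinuousOn.add ?_ ?_) ?_
  · exact ContinuousOn.div (by fun_prop) (by fun_prop) fun u hu => pow_ne_zero 2 (hD u hu)
  · exact ContinuousOn.div (by fun_prop) (by fun_prop)
      fun u hu => mul_ne_zero (h0 u hu) (pow_ne_zero 2 (hD u hu))
  · exact ContinuousOn.div (hL.mul (by fun_prop)) (by fun_prop)
      fun u hu => pow_ne_zero 3 (hD u hu)

/-- The Laplace integral of `rayIntegrand w m` at `c`, after two integrations by parts; in this form
it converges absolutely up to the imaginary axis. -/
noncomputable def partsIntegral (w c : ℂ) (m : ℕ) : ℂ :=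
  -(∫ u : ℝ in Set.Ioi 0, (1 - Complex.exp (-(c * u))) * rayIntegrandDerivTwo w m u) / c ^ 2

theorem exists_norm_parts_le {w : ℂ} (hw : 0 < w.re) :
    ∃ C : ℝ, 0 < C ∧ ∀ (c : ℂ) (m : ℕ) (u : ℝ), 0 ≤ c.re → 0 < u →
      ‖(1 - Complex.exp (-(c * u))) * rayIntegrandDerivTwo w m u‖
        ≤ C * (1 + ‖c‖) * ((m : ℝ) + 1) ^ (-(3 / 2) : ℝ) * partsMajorant u := by
  obtain ⟨C, hC, h⟩ := exists_min_mul_norm_rayIntegrandDerivTwo_le hw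
  refine ⟨2 * C, by positivity, fun c m u hc hu => ?_⟩
  rw [norm_mul]
  calc _ ≤ 2 * (1 + ‖c‖) * min 1 u * ‖rayIntegrandDerivTwo w m u‖ := by
        gcongr
        exact norm_one_sub_exp_neg_le hc hu.le
    _ = 2 * (1 + ‖c‖) * (min 1 u * ‖rayIntegrandDerivTwo w m u‖) := by ring
    _ ≤ 2 * (1 + ‖c‖) * (C * ((m : ℝ) + 1) ^ (-(3 / 2) : ℝ) * partsMajorant u) := by
        exact mul_le_mul_of_nonneg_left (h m u hu) (by positivity)
    _ = _ := by ring

theorem aestronglyMeasurable_parts {w : ℂ} (hw : 0 < w.re) (c : ℂ) (m : ℕ) :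
    AEStronglyMeasurable
      (fun u : ℝ => (1 - Complex.exp (-(c * u))) * rayIntegrandDerivTwo w m u)
      (volume.restrict (Set.Ioi 0)) :=
  ((Continuous.continuousOn (by fun_prop)).mul
    (continuousOn_rayIntegrandDerivTwo hw m)).aestronglyMeasurable measurableSet_Ioi

theorem integrableOn_parts {w c : ℂ} (hw : 0 < w.re) (hc : 0 ≤ c.re) (m : ℕ) :
    IntegrableOn (fun u : ℝ => (1 - Complex.exp (-(c * u))) * rayIntegrandDerivTwo w m u)
      (Set.Ioi 0) := by
  obtain ⟨C, hC, h⟩ := exists_norm_parts_le hw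
  refine (integrableOn_partsMajorant.const_mul
    (C * (1 + ‖c‖) * ((m : ℝ) + 1) ^ (-(3 / 2) : ℝ))).mono' (aestronglyMeasurable_parts hw c m) ?_
  filter_upwards [ae_restrict_mem measurableSet_Ioi] with u hu
  exact h c m u hc hu

theorem exists_norm_partsIntegral_le {w : ℂ} (hw : 0 < w.re) :
    ∃ C : ℝ, 0 < C ∧ ∀ (c : ℂ) (m : ℕ), 0 ≤ c.re →
      ‖partsIntegral w c m‖ ≤ C * (1 + ‖c‖) / ‖c‖ ^ 2 * ((m : ℝ) + 1) ^ (-(3 / 2) : ℝ) := by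
  obtain ⟨C, hC, h⟩ := exists_norm_parts_le hw
  have hM : 0 ≤ ∫ u in Set.Ioi 0, partsMajorant u :=
    setIntegral_nonneg measurableSet_Ioi fun _ hu => partsMajorant_nonneg hu
  refine ⟨C * ((∫ u in Set.Ioi 0, partsMajorant u) + 1), by positivity, fun c m hc => ?_⟩
  have h1 := norm_integral_le_of_norm_le (μ := volume.restrict (Set.Ioi 0))
    (integrableOn_partsMajorant.const_mul (C * (1 + ‖c‖) * ((m : ℝ) + 1) ^ (-(3 / 2) : ℝ)))
    (by filter_upwards [ae_restrict_mem measurableSet_Ioi] with u hu using h c m u hc hu)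
  rw [integral_const_mul] at h1
  rw [partsIntegral, norm_div, norm_neg, norm_pow]
  calc _ ≤ C * (1 + ‖c‖) * ((m : ℝ) + 1) ^ (-(3 / 2) : ℝ)
        * ((∫ u in Set.Ioi 0, partsMajorant u) + 1) / ‖c‖ ^ 2 := by
        gcongr
        refine h1.trans ?_
        gcongr
        linarith
    _ = _ := by ring

theorem tendsto_mul_rpow_div_sq_add_one :
    Tendsto (fun u : ℝ => u * (u ^ (1 / 4 : ℝ) + u ^ (-(1 / 4) : ℝ)) / (u ^ 2 + 1))
      atTop (𝓝 0) ∧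
    Tendsto (fun u : ℝ => u * (u ^ (1 / 4 : ℝ) + u ^ (-(1 / 4) : ℝ)) / (u ^ 2 + 1))
      (𝓝[>] 0) (𝓝 0) := by
  constructor
  · have h : Tendsto (fun u : ℝ => 2 * u ^ (-(3 / 4) : ℝ)) atTop (𝓝 0) := by
      simpa using (tendsto_rpow_neg_atTop (show (0 : ℝ) < 3 / 4 by norm_num)).const_mul 2
    refine squeeze_zero' ?_ ?_ h
    · filter_upwards [eventually_gt_atTop 0] with u hu
      positivity
    · filter_upwards [eventually_ge_atTop 1] with u hu
      have hu0 : 0 < u := by linarith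
      have e : u ^ (-(3 / 4) : ℝ) = u ^ (1 / 4 : ℝ) / u := by
        rw [← Real.rpow_sub_one hu0.ne']; norm_num
      have h1 : 1 ≤ u ^ (1 / 4 : ℝ) := Real.one_le_rpow hu (by norm_num)
      have h2 : u ^ (-(1 / 4) : ℝ) ≤ 1 :=
        Real.rpow_le_one_of_one_le_of_nonpos hu (by norm_num)
      rw [e, ← mul_div_assoc, div_le_div_iff₀ (by positivity) hu0]
      have : u ^ (1 / 4 : ℝ) + u ^ (-(1 / 4) : ℝ) ≤ 2 * u ^ (1 / 4 : ℝ) := by linarith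
      calc u * (u ^ (1 / 4 : ℝ) + u ^ (-(1 / 4) : ℝ)) * u
          = (u ^ (1 / 4 : ℝ) + u ^ (-(1 / 4) : ℝ)) * u ^ 2 := by ring
        _ ≤ 2 * u ^ (1 / 4 : ℝ) * (u ^ 2 + 1) := by gcongr; linarith
  · have h : Tendsto (fun u : ℝ => u ^ (5 / 4 : ℝ) + u ^ (3 / 4 : ℝ)) (𝓝[>] 0) (𝓝 0) := by
      have h1 : ContinuousAt (fun u : ℝ => u ^ (5 / 4 : ℝ) + u ^ (3 / 4 : ℝ)) 0 :=
        (Real.continuousAt_rpow_const 0 _ (Or.inr (by norm_num))).add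
          (Real.continuousAt_rpow_const 0 _ (Or.inr (by norm_num)))
      have h2 := h1.tendsto
      rw [Real.zero_rpow (by norm_num), Real.zero_rpow (by norm_num), add_zero] at h2
      exact h2.mono_left nhdsWithin_le_nhds
    refine squeeze_zero' ?_ ?_ h
    · filter_upwards [self_mem_nhdsWithin] with u hu
      have hu : 0 < u := hu
      positivity
    · filter_upwards [self_mem_nhdsWithin] with u hu
      have hu : 0 < u := hu
      have e1 : u ^ (5 / 4 : ℝ) = u * u ^ (1 / 4 : ℝ) := by
        nth_rewrite 2 [← Real.rpow_one u]; rw [← Real.rpow_add hu]; norm_num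
      have e2 : u ^ (3 / 4 : ℝ) = u * u ^ (-(1 / 4) : ℝ) := by
        nth_rewrite 2 [← Real.rpow_one u]; rw [← Real.rpow_add hu]; norm_num
      rw [e1, e2, ← mul_add]
      exact div_le_self (by positivity) (by nlinarith)

theorem exists_norm_partsPrimitive_le {w c : ℂ} (hw : 0 < w.re) (hc : 0 ≤ c.re) (m : ℕ) :
    ∃ C : ℝ, ∀ u : ℝ, 0 < u → ‖partsPrimitive w c m u‖
      ≤ C * (u * (u ^ (1 / 4 : ℝ) + u ^ (-(1 / 4) : ℝ)) / (u ^ 2 + 1)) := by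
  obtain ⟨C, hC, h⟩ := exists_norm_rayIntegrand_le hw
  refine ⟨2 * (1 + ‖c‖) * C / ‖c‖ ^ 2 + C / ‖c‖, fun u hu => ?_⟩
  set W := u ^ (1 / 4 : ℝ) + u ^ (-(1 / 4) : ℝ) with hW
  have hW0 : 0 ≤ W := by positivity
  have h1 : ‖1 - Complex.exp (-(c * u))‖ ≤ 2 * (1 + ‖c‖) * u :=
    (norm_one_sub_exp_neg_le hc hu.le).trans (by gcongr; exact min_le_right _ _)
  have h2 : ‖Complex.exp (-(c * u))‖ ≤ 1 := by
    rw [norm_exp_neg_mul_ofReal, Real.exp_le_one_iff]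
    nlinarith [mul_nonneg hc hu.le]
  rw [partsPrimitive]
  refine (norm_sub_le _ _).trans ?_
  rw [norm_div, norm_div, norm_mul, norm_mul, norm_pow]
  calc _ ≤ 2 * (1 + ‖c‖) * u * (C * (W / (u ^ 2 + 1))) / ‖c‖ ^ 2
        + 1 * (C * (u * W / (u ^ 2 + 1))) / ‖c‖ := by
        have := (h m u hu).1
        have := (h m u hu).2
        gcongr
    _ = _ := by ring

theorem intervalIntegrable_exp_mul_rayIntegrand {w c : ℂ} (hw : 0 < w.re) (hc : 0 ≤ c.re) (m : ℕ)
    {T : ℝ} (hT : 0 < T) :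
    IntervalIntegrable (fun u : ℝ => Complex.exp (-(c * u)) * rayIntegrand w m u) volume 0 T := by
  obtain ⟨C, hC, h⟩ := exists_norm_rayIntegrand_le hw
  rw [intervalIntegrable_iff_integrableOn_Ioc_of_le hT.le]
  refine (integrable_const (C * 2)).mono' ?_ ?_
  · exact (((Continuous.continuousOn (by fun_prop)).mul (continuousOn_rayIntegrand hw m)).mono
      Set.Ioc_subset_Ioi_self).aestronglyMeasurable measurableSet_Ioc
  · filter_upwards [ae_restrict_mem measurableSet_Ioc] with u hu
    have hu : 0 < u := hu.1
    have h2 : ‖Complex.exp (-(c * u))‖ ≤ 1 := by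
      rw [norm_exp_neg_mul_ofReal, Real.exp_le_one_iff]
      nlinarith [mul_nonneg hc hu.le]
    have h3 : u * (u ^ (1 / 4 : ℝ) + u ^ (-(1 / 4) : ℝ)) / (u ^ 2 + 1) ≤ 2 := by
      rw [div_le_iff₀ (by positivity)]
      rcases le_total u 1 with h | h
      · have h1 : u ^ (1 / 4 : ℝ) ≤ 1 := Real.rpow_le_one hu.le h (by norm_num)
        have h4 : u * u ^ (-(1 / 4) : ℝ) ≤ 1 := by
          nth_rewrite 1 [← Real.rpow_one u]
          rw [← Real.rpow_add hu]
          exact Real.rpow_le_one hu.le h (by norm_num)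
        have h5 : u * u ^ (1 / 4 : ℝ) ≤ 1 := mul_le_one₀ h (by positivity) h1
        nlinarith
      · have h1 : u ^ (1 / 4 : ℝ) ≤ u := by
          simpa using Real.rpow_le_rpow_of_exponent_le h (show (1 / 4 : ℝ) ≤ 1 by norm_num)
        have h4 : u ^ (-(1 / 4) : ℝ) ≤ 1 :=
          Real.rpow_le_one_of_one_le_of_nonpos h (by norm_num)
        nlinarith
    rw [norm_mul]
    calc _ ≤ 1 * (C * 2) := by
          refine mul_le_mul h2 (((h m u hu).1).trans ?_) (norm_nonneg _) zero_le_one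
          gcongr
      _ = _ := one_mul _

/-- Two integrations by parts on `[0, T]`, followed by `T → ∞`. -/
theorem tendsto_integral_exp_mul_rayIntegrand {w c : ℂ} (hw : 0 < w.re) (hc : 0 ≤ c.re)
    (hc0 : c ≠ 0) (m : ℕ) :
    Tendsto (fun T : ℝ => ∫ u in (0 : ℝ)..T, Complex.exp (-(c * u)) * rayIntegrand w m u) atTop
      (𝓝 (partsIntegral w c m)) := by
  obtain ⟨C, hC⟩ := exists_norm_partsPrimitive_le hw hc m
  -- At `u = 0` the formula takes the value `0`, whatever the junk value of `log 0`.
  have h0 : partsPrimitive w c m 0 = 0 := by simp [partsPrimitive, rayIntegrand]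
  have hQtop : Tendsto (partsPrimitive w c m) atTop (𝓝 0) := by
    have hlim := tendsto_mul_rpow_div_sq_add_one.1.const_mul C
    rw [mul_zero] at hlim
    refine squeeze_zero_norm' ?_ hlim
    filter_upwards [eventually_gt_atTop 0] with u hu using hC u hu
  have hQ0 : Tendsto (partsPrimitive w c m) (𝓝[>] 0) (𝓝 0) := by
    have hlim := tendsto_mul_rpow_div_sq_add_one.2.const_mul C
    rw [mul_zero] at hlim
    refine squeeze_zero_norm' ?_ hlim
    filter_upwards [self_mem_nhdsWithin] with u hu using hC u hu
  have hpi : IntegrableOn (fun u : ℝ => (1 - Complex.exp (-(c * u)))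
      * rayIntegrandDerivTwo w m u / c ^ 2) (Set.Ioi 0) :=
    (integrableOn_parts hw hc m).div_const (c ^ 2)
  have hparts : ∀ T : ℝ, 0 < T →
      IntervalIntegrable (fun u : ℝ => (1 - Complex.exp (-(c * u))) * rayIntegrandDerivTwo w m u
        / c ^ 2) volume 0 T := fun T hT =>
    (intervalIntegrable_iff_integrableOn_Ioc_of_le hT.le).mpr (hpi.mono_set Set.Ioc_subset_Ioi_self)
  have hlim := hQtop.sub (intervalIntegral_tendsto_integral_Ioi 0 hpi tendsto_id)
  have hval : 0 - ∫ u : ℝ in Set.Ioi 0,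
      (1 - Complex.exp (-(c * u))) * rayIntegrandDerivTwo w m u / c ^ 2 = partsIntegral w c m := by
    rw [integral_div, partsIntegral]; ring
  rw [hval] at hlim
  refine hlim.congr' ?_
  filter_upwards [eventually_gt_atTop 0] with T hT
  have hf := intervalIntegrable_exp_mul_rayIntegrand hw hc m hT
  have hcont : ContinuousOn (partsPrimitive w c m) (Set.Icc 0 T) := by
    intro u hu
    rcases hu.1.eq_or_lt with h | h
    · subst h
      have : ContinuousWithinAt (partsPrimitive w c m) (Set.Ioi 0) 0 := by
        rw [ContinuousWithinAt, h0]; exact hQ0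
      exact (continuousWithinAt_Ioi_iff_Ici.mp this).mono Set.Icc_subset_Ici_self
    · exact (hasDerivAt_partsPrimitive hw hc0 m h).continuousAt.continuousWithinAt
  have hFTC := intervalIntegral.integral_eq_sub_of_hasDerivAt_of_le hT.le hcont
    (fun u hu => hasDerivAt_partsPrimitive hw hc0 m hu.1) (hf.add (hparts T hT))
  rw [intervalIntegral.integral_add hf (hparts T hT), h0, sub_zero] at hFTC
  simp only [id]
  rw [← hFTC]
  ring

/-- Continuity of the regularised integrals up to the imaginary axis. -/
theorem tendsto_partsIntegral {w : ℂ} (hw : 0 < w.re) {c₀ : ℂ} (hne : c₀ ≠ 0)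
    {c : ℕ → ℂ} (hc : ∀ k, 0 ≤ (c k).re) (hlim : Tendsto c atTop (𝓝 c₀)) (m : ℕ) :
    Tendsto (fun k => partsIntegral w (c k) m) atTop (𝓝 (partsIntegral w c₀ m)) := by
  obtain ⟨C, hC, h⟩ := exists_norm_parts_le hw
  obtain ⟨R, hR⟩ : ∃ R, ∀ k, ‖c k‖ ≤ R := by
    obtain ⟨R, hR⟩ := (Metric.isBounded_range_of_tendsto c hlim).exists_norm_le
    exact ⟨R, fun k => hR _ ⟨k, rfl⟩⟩
  refine (Tendsto.neg ?_).div (hlim.pow 2) (pow_ne_zero 2 hne)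
  refine tendsto_integral_of_dominated_convergence
    (fun u => C * (1 + R) * ((m : ℝ) + 1) ^ (-(3 / 2) : ℝ) * partsMajorant u)
    (fun k => aestronglyMeasurable_parts hw (c k) m)
    (integrableOn_partsMajorant.const_mul _) (fun k => ?_) ?_
  · filter_upwards [ae_restrict_mem measurableSet_Ioi] with u hu
    have hu : 0 < u := hu
    refine (h (c k) m u (hc k) hu).trans ?_
    have := partsMajorant_nonneg hu
    have := hR k
    gcongr
  · filter_upwards with u
    refine Tendsto.mul_const _ (tendsto_const_nhds.sub ?_)
    exact (Complex.continuous_exp.tendsto _).comp (hlim.mul_const _).neg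

/-- Summation of the regularised integrals inside the half-plane: dominated convergence and the
partial fraction expansion of the Binet kernel. -/
theorem tsum_partsIntegral {w c : ℂ} (hw : 0 < w.re) (hc : 0 < c.re) :
    ∑' m : ℕ, partsIntegral w c m
      = (∫ u : ℝ in Set.Ioi 0, Complex.exp (-(c * u)) * logRay w u * binetKernel w u)
        / (2 * w) := by
  have hc0 : c ≠ 0 := by rintro rfl; simp at hc
  obtain ⟨C, hC, hh⟩ := exists_norm_div_le hw
  have hω : IsLogWeight (logRay w) := by simpa using isLogWeight_logRay_add w 0
  set h : ℕ → ℝ → ℂ := fun m u => (u : ℂ) / ((u : ℂ) ^ 2 + poleParam w m ^ 2) with hdef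
  have hhm : ∀ m : ℕ, AEStronglyMeasurable (h m) (volume.restrict (Set.Ioi 0)) := fun m =>
    ContinuousOn.aestronglyMeasurable (ContinuousOn.div (by fun_prop) (by fun_prop) fun u hu =>
      sq_add_poleParam_sq_ne_zero hw m (le_of_lt hu)) measurableSet_Ioi
  have hb : ∀ (m : ℕ) (u : ℝ), 0 < u →
      ‖h m u‖ ≤ C * ((m : ℝ) + 1) ^ (-(3 / 2) : ℝ) * (1 + u ^ (1 / 2 : ℝ)) := by
    intro m u hu
    refine (hh m u hu).trans ?_
    gcongr
    linarith
  have hint : ∀ m : ℕ, IntegrableOn (fun u : ℝ => Complex.exp (-(c * u)) * logRay w u * h m u)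
      (Set.Ioi 0) := fun m => hω.integrableOn_exp_mul hc (hhm m) (hb m)
  have heq : ∀ m : ℕ, partsIntegral w c m
      = ∫ u : ℝ in Set.Ioi 0, Complex.exp (-(c * u)) * logRay w u * h m u := by
    intro m
    refine tendsto_nhds_unique (tendsto_integral_exp_mul_rayIntegrand hw hc.le hc0 m) ?_
    refine (intervalIntegral_tendsto_integral_Ioi 0 (hint m) tendsto_id).congr fun T => ?_
    refine intervalIntegral.integral_congr fun u _ => ?_
    simp only [rayIntegrand, hdef]
    ring
  obtain ⟨C₁, hC₁, hL⟩ := hω.2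
  have hsum := hasSum_integral_of_dominated_convergence (μ := volume.restrict (Set.Ioi 0))
    (F := fun (m : ℕ) (u : ℝ) => Complex.exp (-(c * u)) * logRay w u * h m u)
    (f := fun u : ℝ => Complex.exp (-(c * u)) * logRay w u * (binetKernel w u / (2 * w)))
    (fun m u => C₁ * C * ((m : ℝ) + 1) ^ (-(3 / 2) : ℝ) * (Real.exp (-c.re * u) *
      ((u ^ (1 / 4 : ℝ) + u ^ (-(1 / 4) : ℝ)) * (1 + u ^ (1 / 2 : ℝ)))))
    (fun m => (hint m).aestronglyMeasurable) (fun m => ?_) ?_ ?_ ?_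
  · simp_rw [heq]
    rw [hsum.tsum_eq, ← integral_div]
    refine integral_congr_ae (Eventually.of_forall fun u => ?_)
    simp only
    ring
  · filter_upwards [ae_restrict_mem measurableSet_Ioi] with u hu
    have hu : 0 < u := hu
    rw [norm_mul, norm_mul, norm_exp_neg_mul_ofReal]
    calc _ ≤ Real.exp (-c.re * u) * (C₁ * (u ^ (1 / 4 : ℝ) + u ^ (-(1 / 4) : ℝ)))
          * (C * ((m : ℝ) + 1) ^ (-(3 / 2) : ℝ) * (1 + u ^ (1 / 2 : ℝ))) := by
          have := hL u hu
          have := hb m u hu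
          gcongr
      _ = _ := by ring
  · exact Eventually.of_forall fun u => (summable_succ_rpow.mul_left (C₁ * C)).mul_right _
  · simp_rw [tsum_mul_right]
    exact (integrableOn_exp_mul_logWeight_bound hc).const_mul _
  · filter_upwards [ae_restrict_mem measurableSet_Ioi] with u hu
    exact (hasSum_binetKernel hw hu).mul_left _

/-- The closed form for the sum, extended to the imaginary axis by the limit `c + 1/(k+1) → c`. -/
theorem tsum_partsIntegral_of_re_nonneg {w c : ℂ} (hw : 0 < w.re) (hc : 0 ≤ c.re) (hc0 : c ≠ 0)
    (hs : c * w ∈ Complex.slitPlane) :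
    ∑' m : ℕ, partsIntegral w c m
      = (psiOne (c * w) + Complex.log (c * w) / (2 * (c * w)) - Complex.log (c * w) ^ 2 / 2
        + (Real.eulerMascheroniConstant : ℂ) * (Complex.digamma (c * w) - Complex.log (c * w)
          + 1 / (2 * (c * w)))) / 2 := by
  have hw0 : w ≠ 0 := by rintro rfl; simp at hw
  set d : ℕ → ℂ := fun k => c + ((1 / ((k : ℝ) + 1) : ℝ) : ℂ) with hd
  have hdre : ∀ k, 0 < (d k).re := by
    intro k
    have : 0 < 1 / ((k : ℝ) + 1) := by positivity
    simp only [hd, Complex.add_re, Complex.ofReal_re]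
    linarith
  have hdlim : Tendsto d atTop (𝓝 c) := by
    have h := (Complex.continuous_ofReal.tendsto 0).comp
      (tendsto_one_div_add_atTop_nhds_zero_nat (𝕜 := ℝ))
    have h' := h.const_add c
    rw [Complex.ofReal_zero, add_zero] at h'
    exact h'
  obtain ⟨C, hC, hb⟩ := exists_norm_partsIntegral_le hw
  have hbd : ∀ᶠ k in atTop,
      C * (1 + ‖d k‖) / ‖d k‖ ^ 2 ≤ C * (1 + ‖c‖) / ‖c‖ ^ 2 + 1 := by
    have : Tendsto (fun k => C * (1 + ‖d k‖) / ‖d k‖ ^ 2) atTop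
        (𝓝 (C * (1 + ‖c‖) / ‖c‖ ^ 2)) :=
      ((hdlim.norm.const_add 1).const_mul C).div (hdlim.norm.pow 2)
        (pow_ne_zero 2 (norm_ne_zero_iff.mpr hc0))
    exact this.eventually_le_const (by linarith)
  have h1 : Tendsto (fun k => ∑' m : ℕ, partsIntegral w (d k) m) atTop
      (𝓝 (∑' m : ℕ, partsIntegral w c m)) := by
    refine tendsto_tsum_of_dominated_convergence
      (summable_succ_rpow.mul_left (C * (1 + ‖c‖) / ‖c‖ ^ 2 + 1))
      (fun m => tendsto_partsIntegral hw hc0 (fun k => (hdre k).le) hdlim m) ?_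
    filter_upwards [hbd] with k hk m
    refine (hb (d k) m (hdre k).le).trans ?_
    gcongr
  set Φ : ℂ → ℂ := fun z => (psiOne z + Complex.log z / (2 * z) - Complex.log z ^ 2 / 2
        + (Real.eulerMascheroniConstant : ℂ) * (Complex.digamma z - Complex.log z
          + 1 / (2 * z))) / 2 with hΦ
  have hcont : ContinuousAt Φ (c * w) := by
    have hz0 := Complex.slitPlane_ne_zero hs
    have hl := continuousAt_clog hs
    have hm : ContinuousAt (fun z : ℂ => 2 * z) (c * w) := by fun_prop
    have hm0 : 2 * (c * w) ≠ 0 := mul_ne_zero two_ne_zero hz0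
    exact ((((continuousAt_psiOne hs).add (hl.div hm hm0)).sub ((hl.pow 2).div_const 2)).add
      (continuousAt_const.mul (((continuousAt_digamma hs).sub hl).add
        (continuousAt_const.div hm hm0)))).div_const 2
  have h2 : Tendsto (fun k => Φ (d k * w)) atTop (𝓝 (Φ (c * w))) :=
    hcont.tendsto.comp (hdlim.mul_const w)
  refine tendsto_nhds_unique h1 (h2.congr fun k => ?_)
  rw [tsum_partsIntegral hw (hdre k), integral_logRay_mul_binetKernel hw (hdre k)]
  simp only [hΦ]
  field_simp

theorem log_I_mul {w : ℂ} (hw : 0 < w.re) :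
    Complex.log (Complex.I * w) = Complex.log w + Real.pi / 2 * Complex.I ∧
    Complex.log (-(Complex.I * w)) = Complex.log w - Real.pi / 2 * Complex.I := by
  have hw0 : w ≠ 0 := by rintro rfl; simp at hw
  have h := abs_lt.mp (Complex.abs_arg_lt_pi_div_two_iff.mpr (Or.inl hw))
  constructor
  · rw [Complex.log_mul Complex.I_ne_zero hw0 ⟨?_, ?_⟩, Complex.log_I]
    · ring
    all_goals rw [Complex.arg_I]; linarith [h.1, h.2]
  · rw [← neg_mul, Complex.log_mul (neg_ne_zero.mpr Complex.I_ne_zero) hw0 ⟨?_, ?_⟩,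
      Complex.log_neg_I]
    · ring
    all_goals rw [Complex.arg_neg_I]; linarith [h.1, h.2]

theorem theorem3p4 (w : ℂ) (hw : 0 < w.re) :
    ∃ J : ℕ → ℂ,
      (∀ m : ℕ, HasImproperIntegral
        (fun u : ℝ => (u : ℂ) * Complex.cos (u : ℂ) * Complex.log ((u : ℂ) / w) /
          ((u : ℂ) ^ 2 + (2 * (Real.pi : ℂ) * ((m + 1 : ℕ) : ℂ) * w) ^ 2)) (J m)) ∧
      Summable J ∧
      4 * ∑' m : ℕ, J m =
        psiOne (Complex.I * w) - 1 / 2 * Complex.log (Complex.I * w) ^ 2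
          + psiOne (-(Complex.I * w)) - 1 / 2 * Complex.log (-(Complex.I * w)) ^ 2
          + (Real.pi : ℂ) / (2 * w)
          + (Real.eulerMascheroniConstant : ℂ) *
              (Complex.digamma (Complex.I * w) + Complex.digamma (-(Complex.I * w))
                - 2 * Complex.log w) := by
  have hw0 : w ≠ 0 := by rintro rfl; simp at hw
  have hI0 : (0 : ℝ) ≤ Complex.I.re := by simp
  have hI0' : (0 : ℝ) ≤ (-Complex.I).re := by simp
  have hIne : -Complex.I ≠ 0 := neg_ne_zero.mpr Complex.I_ne_zero
  have hsum : ∀ c : ℂ, 0 ≤ c.re → Summable (partsIntegral w c) := by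
    intro c hc
    obtain ⟨C, hC, hb⟩ := exists_norm_partsIntegral_le hw
    exact Summable.of_norm_bounded (summable_succ_rpow.mul_left _) fun m => hb c m hc
  have hcos : ∀ (m : ℕ) (u : ℝ), 0 < u →
      (Complex.exp (-(Complex.I * u)) * rayIntegrand w m u
        + Complex.exp (-(-Complex.I * u)) * rayIntegrand w m u) / 2
      = (u : ℂ) * Complex.cos (u : ℂ) * Complex.log ((u : ℂ) / w) /
          ((u : ℂ) ^ 2 + (2 * (Real.pi : ℂ) * ((m + 1 : ℕ) : ℂ) * w) ^ 2) := by
    intro m u hu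
    rw [log_ofReal_div_eq_logRay hw hu, rayIntegrand, poleParam, Complex.cos,
      show -(Complex.I * (u : ℂ)) = -(u : ℂ) * Complex.I by ring,
      show -(-Complex.I * (u : ℂ)) = (u : ℂ) * Complex.I by ring]
    ring
  refine ⟨fun m => (partsIntegral w Complex.I m + partsIntegral w (-Complex.I) m) / 2,
    fun m => ⟨fun T hT => ?_, ?_⟩, ((hsum _ hI0).add (hsum _ hI0')).div_const 2, ?_⟩
  · refine (((intervalIntegrable_exp_mul_rayIntegrand hw hI0 m hT).add
      (intervalIntegrable_exp_mul_rayIntegrand hw hI0' m hT)).div_const 2).congr ?_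
    intro u hu
    rw [Set.uIoc_of_le hT.le] at hu
    exact hcos m u hu.1
  · have h := ((tendsto_integral_exp_mul_rayIntegrand hw hI0 Complex.I_ne_zero m).add
      (tendsto_integral_exp_mul_rayIntegrand hw hI0' hIne m)).div_const 2
    refine h.congr' ?_
    filter_upwards [eventually_gt_atTop 0] with T hT
    rw [← intervalIntegral.integral_add (intervalIntegrable_exp_mul_rayIntegrand hw hI0 m hT)
      (intervalIntegrable_exp_mul_rayIntegrand hw hI0' m hT), ← intervalIntegral.integral_div,
      intervalIntegral.integral_of_le hT.le, intervalIntegral.integral_of_le hT.le]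
    exact setIntegral_congr_fun measurableSet_Ioc fun u hu => hcos m u hu.1
  · have hs1 : Complex.I * w ∈ Complex.slitPlane := Or.inr (by simpa using hw.ne')
    have hs2 : -Complex.I * w ∈ Complex.slitPlane := Or.inr (by simpa using hw.ne')
    rw [tsum_div_const, (hsum _ hI0).tsum_add (hsum _ hI0'),
      tsum_partsIntegral_of_re_nonneg hw hI0 Complex.I_ne_zero hs1,
      tsum_partsIntegral_of_re_nonneg hw hI0' hIne hs2, neg_mul]
    have hpi : (Real.pi : ℂ) / (2 * w)
        = Complex.log (Complex.I * w) / (2 * (Complex.I * w))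
          + Complex.log (-(Complex.I * w)) / (2 * -(Complex.I * w)) := by
      rw [(log_I_mul hw).1, (log_I_mul hw).2]
      have := Complex.I_ne_zero
      field_simp
      ring
    have hlog : 2 * Complex.log w
        = Complex.log (Complex.I * w) + Complex.log (-(Complex.I * w)) := by
      rw [(log_I_mul hw).1, (log_I_mul hw).2]
      ring
    have hinv : 1 / (2 * -(Complex.I * w)) = -(1 / (2 * (Complex.I * w))) := by
      rw [mul_neg, one_div, inv_neg, one_div]
    rw [hpi, hlog, hinv]
    ring
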